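/- Let $0<p<1$, $\lambda=\min\{p,1-p\}$ and $c=1/(8\ln(1/\lambda))$. For $r\ge 0$ and $m\ge 0$ let $\mathrm{RM}(r,m)\subseteq\mathbb F_2^{2^m}$ be the binary Reed--Muller code, i.e. the set of evaluations at all points of $\mathbb F_2^m$ of the $m$-variate polynomials over $\mathbb F_2$ of degree at most $r$ (and degree at most one in each variable); bit $0$ of a codeword is its value at the point $0$. For a binary code $\mathcal C$ of length $N$ let $X$ be a uniformly random codeword, let $Y$ be the output of the binary symmetric channel with error probability $p$ when $X$ is sent, and let $P_b(\mathcal C)$ be the probability that a bit-MAP decoder (a rule choosing a most likely value of $X_0$ given the extrinsic observation $Y_{\sim 0}=(Y_1,\dots,Y_{N-1})$, ties being broken arbitrarily) decodes $X_0$ incorrectly. This probability does not depend on how ties are broken. Fix $r,m\ge 0$, and put $\mathcal C'=\mathrm{RM}(r,m)$. (1) For every integer $0\le \ell\le m$, the code $\mathcal C=\mathrm{RM}(r,m+2\ell)$ contains three $\mathcal C'$ looks at bit $0$ with fractional overlap $2^{-\ell}$: there are pairwise disjoint sets $A,B_1,B_2,B_3$ of non-zero bit positions of $\mathcal C$ such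 that, for each $i$, the projection of $\mathcal C$ onto the positions $\{0\}\cup A\cup B_i$ equals $\mathcal C'$ after a relabelling of the positions which maps bit $0$ to bit $0$, and $|\{0\}\cup A|/|\{0\}\cup A\cup B_i|=2^{-\ell}$. (2) For every integer $\ell\ge 0$, with $\mathcal C=\mathrm{RM}(r,m+2\ell)$, $$P_b(\mathcal C)\le 3\Big(P_b(\mathcal C')^2+2^{-\ell}P_b(\mathcal C')^{7/6}+\big(-c\ln P_b(\mathcal C')\big)^{-\ell}P_b(\mathcal C')\Big).$$ (3) For $\ell=2$, i.e. $\mathcal C=\mathrm{RM}(r,m+4)$, $$P_b(\mathcal C)\le P_b(\mathcal C')\left(\frac{2}{c\ln(1/P_b(\mathcal C'))}\right)^2 .$$ -/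

import Mathlib

open Finset

/-- The binary Reed-Muller code `RM(r, m)`: evaluations, at all points of `𝔽₂^m`, of the
`m`-variate polynomials over `𝔽₂` of total degree at most `r` and of degree at most one in
each variable. The code positions are the points of `𝔽₂^m` (the integer `k < 2^m` of the usual
enumeration is identified with its binary expansion, so that bit `0` is the point `0`). -/
noncomputable def reedMuller (r m : ℕ) :
    Submodule (ZMod 2) ((Fin m → ZMod 2) → ZMod 2) :=
  (MvPolynomial.restrictTotalDegree (Fin m) (ZMod 2) r ⊓
    MvPolynomial.restrictDegree (Fin m) (ZMod 2) 1).map (MvPolynomial.evalₗ (ZMod 2) (Fin m))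

/-- Transition probability from input `x` to output `y` of the binary symmetric channel with
error probability `p`. -/
def bscProb (p : ℝ) (x y : ZMod 2) : ℝ := if y = x then 1 - p else p

section Decoding

variable {ι : Type*} [Fintype ι] [DecidableEq ι]

open Classical in
/-- `Pr(X_{i₀} = b, Y_{∼i₀} = y)`, where `X` is a uniformly random codeword of `C` and `Y` is
the output of the memoryless channel BSC(`p`) with input `X`; the vector `y` is indexed by all
positions except `i₀` (the extrinsic observation). -/
noncomputable def extrinsicJointProb (p : ℝ) (C : Submodule (ZMod 2) (ι → ZMod 2)) (i₀ : ι)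
    (b : ZMod 2) (y : {i : ι // i ≠ i₀} → ZMod 2) : ℝ :=
  ∑ x : ι → ZMod 2 with x ∈ C ∧ x i₀ = b,
    (Nat.card C : ℝ)⁻¹ * ∏ i : {i : ι // i ≠ i₀}, bscProb p (x i) (y i)

/-- `g` is an extrinsic bit-MAP decoder for bit `i₀` of `C` on BSC(`p`): `g y` is a value of
`X_{i₀}` of maximal posterior probability given `Y_{∼i₀} = y`, with an arbitrary choice in case
of a tie. (Posterior probabilities are compared after multiplication by `Pr(Y_{∼i₀} = y)`.) -/
def IsExtrinsicBitMAP (p : ℝ) (C : Submodule (ZMod 2) (ι → ZMod 2)) (i₀ : ι)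
    (g : ({i : ι // i ≠ i₀} → ZMod 2) → ZMod 2) : Prop :=
  ∀ y b, extrinsicJointProb p C i₀ b y ≤ extrinsicJointProb p C i₀ (g y) y

/-- `Pr(g(Y_{∼i₀}) ≠ X_{i₀})`, the probability that the decoder `g` gets bit `i₀` wrong. For a
bit-MAP decoder `g` this is the extrinsic bit error rate `P_b(C)`. -/
noncomputable def extrinsicBitErrorProb (p : ℝ) (C : Submodule (ZMod 2) (ι → ZMod 2)) (i₀ : ι)
    (g : ({i : ι // i ≠ i₀} → ZMod 2) → ZMod 2) : ℝ :=
  ∑ y : {i : ι // i ≠ i₀} → ZMod 2, ∑ b : ZMod 2 with g y ≠ b, extrinsicJointProb p C i₀ b y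

/-- Bit-MAP decoders exist. -/
theorem exists_isExtrinsicBitMAP (p : ℝ) (C : Submodule (ZMod 2) (ι → ZMod 2)) (i₀ : ι) :
    ∃ g, IsExtrinsicBitMAP p C i₀ g := by
  have h : ∀ y : {i : ι // i ≠ i₀} → ZMod 2, ∃ a : ZMod 2, ∀ b : ZMod 2,
      extrinsicJointProb p C i₀ b y ≤ extrinsicJointProb p C i₀ a y := fun y =>
    Finite.exists_max fun b => extrinsicJointProb p C i₀ b y
  choose g hg using h
  exact ⟨g, hg⟩

/-- The error probability of a bit-MAP decoder does not depend on how ties are broken. -/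
theorem extrinsicBitErrorProb_congr {p : ℝ} {C : Submodule (ZMod 2) (ι → ZMod 2)} {i₀ : ι}
    {g h : ({i : ι // i ≠ i₀} → ZMod 2) → ZMod 2} (hg : IsExtrinsicBitMAP p C i₀ g)
    (hh : IsExtrinsicBitMAP p C i₀ h) :
    extrinsicBitErrorProb p C i₀ g = extrinsicBitErrorProb p C i₀ h := by
  unfold extrinsicBitErrorProb
  refine Finset.sum_congr rfl fun y _ => ?_
  have e := le_antisymm (hh y (g y)) (hg y (h y))
  have hs : ∀ a : ZMod 2, (∑ b : ZMod 2 with a ≠ b, extrinsicJointProb p C i₀ b y) =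
      (∑ b : ZMod 2, extrinsicJointProb p C i₀ b y) - extrinsicJointProb p C i₀ a y := by
    intro a
    rw [Finset.filter_ne, Finset.sum_erase_eq_sub (Finset.mem_univ a)]
  rw [hs, hs, e]

end Decoding

/-- The set `A` of positions of `C` provides a `C'` look at bit `i₀`: after a relabelling of `A`
by the positions of `C'` under which `i₀` corresponds to `k₀`, the projection of `C` onto the
positions in `A` is `C'`. -/
def IsLook {ι κ : Type*} (C : Submodule (ZMod 2) (ι → ZMod 2)) (i₀ : ι)
    (C' : Submodule (ZMod 2) (κ → ZMod 2)) (k₀ : κ) (A : Finset ι) : Prop :=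
  ∃ e : κ ≃ A, (e k₀ : ι) = i₀ ∧
    (fun (c : ι → ZMod 2) (k : κ) => c (e k)) '' (C : Set (ι → ZMod 2)) = (C' : Set (κ → ZMod 2))

/-- The constant `c = 1 / (8 ln(1/λ))` with `λ = min(p, 1 - p)`. -/
noncomputable def levelConst (p : ℝ) : ℝ := 1 / (8 * Real.log (1 / min p (1 - p)))

/-! The bit-MAP decoder with uniform tie-breaking commutes with adding codewords, so its error
probability `P` is the mean of a `[0, 1]`-valued function `F` of the noise alone. Decode each of
three looks with `F` and take a majority vote. By a union bound over pairs it suffices to bound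
`E[F_i F_j]` for two looks (`extrinsicBitErrorProb_le_of_three_looks`).

Two looks share only the positions in a subspace of codimension `ℓ` (zero if `ℓ > m`). In the
`p`-biased Fourier expansion, `E[F_i F_j]` is therefore at most the weight of `F` on sets inside
that subspace (`noiseExp_comp_mul_comp`). Linear automorphisms preserve the code, hence the weights,
so the subspace may be replaced by the common kernel of `ℓ` random functionals. A set `S` of
non-zero points spans at least `|S| + 1` points, so it lies in that kernel with probability at most
`(|S| + 1)^(-ℓ)` (`sum_powerset_headSubspace_le`).

Three ranges of `S` give the three terms of (2). The empty set contributes `P²`. Non-empty sets of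
size at most `c ln(1/P)` gain `2^(-ℓ)` and have total weight at most `P^(7/6)`, by a level
inequality derived from hypercontractivity. The remaining sets gain `(c ln(1/P))^(-ℓ)` and have
weight at most `P` by Parseval. Statement (3) is then a numerical estimate. -/

set_option linter.unusedSectionVars false

/-! ### Fourier analysis of i.i.d. Bernoulli(`p`) bits. -/

section BiasedFourier

variable {ι : Type*} [Fintype ι] [DecidableEq ι] {p : ℝ}

theorem sum_zmod_two (f : ZMod 2 → ℝ) : ∑ b, f b = f 0 + f 1 := Fin.sum_univ_two f

theorem zmod_two_eq_zero_or_one (b : ZMod 2) : b = 0 ∨ b = 1 := by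
  revert b; decide

@[simp] theorem bscProb_zero_zero (p : ℝ) : bscProb p 0 0 = 1 - p := by simp [bscProb]

@[simp] theorem bscProb_zero_one (p : ℝ) : bscProb p 0 1 = p := by simp [bscProb]

theorem bscProb_pos (hp0 : 0 < p) (hp1 : p < 1) (x y : ZMod 2) : 0 < bscProb p x y := by
  unfold bscProb; split_ifs <;> linarith

/-- Expectation of a function of i.i.d. Bernoulli(`p`) bits (the noise of the BSC). -/
noncomputable def noiseExp (p : ℝ) (F : (ι → ZMod 2) → ℝ) : ℝ :=
  ∑ z, (∏ i, bscProb p 0 (z i)) * F z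

/-- The centred and normalized function of a Bernoulli(`p`) bit. -/
noncomputable def biasedSign (p : ℝ) (b : ZMod 2) : ℝ :=
  if b = 0 then √(p / (1 - p)) else -√((1 - p) / p)

/-- The `p`-biased Fourier character of a set of coordinates. -/
noncomputable def biasedChar (p : ℝ) (S : Finset ι) (z : ι → ZMod 2) : ℝ :=
  ∏ i ∈ S, biasedSign p (z i)

/-- The `p`-biased Fourier coefficient. -/
noncomputable def biasedCoeff (p : ℝ) (F : (ι → ZMod 2) → ℝ) (S : Finset ι) : ℝ :=
  noiseExp p fun z => F z * biasedChar p S z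

theorem noiseWeight_nonneg (hp0 : 0 < p) (hp1 : p < 1) (z : ι → ZMod 2) :
    0 ≤ ∏ i, bscProb p 0 (z i) :=
  prod_nonneg fun _ _ => (bscProb_pos hp0 hp1 _ _).le

theorem noiseExp_mono (hp0 : 0 < p) (hp1 : p < 1) {F G : (ι → ZMod 2) → ℝ} (h : ∀ z, F z ≤ G z) :
    noiseExp p F ≤ noiseExp p G :=
  sum_le_sum fun z _ => mul_le_mul_of_nonneg_left (h z) (noiseWeight_nonneg hp0 hp1 z)

theorem noiseExp_nonneg (hp0 : 0 < p) (hp1 : p < 1) {F : (ι → ZMod 2) → ℝ} (h : ∀ z, 0 ≤ F z) :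
    0 ≤ noiseExp p F :=
  sum_nonneg fun z _ => mul_nonneg (noiseWeight_nonneg hp0 hp1 z) (h z)

theorem noiseExp_add (F G : (ι → ZMod 2) → ℝ) :
    noiseExp p (fun z => F z + G z) = noiseExp p F + noiseExp p G := by
  simp only [noiseExp, mul_add, sum_add_distrib]

theorem noiseExp_const_mul (a : ℝ) (F : (ι → ZMod 2) → ℝ) :
    noiseExp p (fun z => a * F z) = a * noiseExp p F := by
  simp only [noiseExp, mul_sum, mul_left_comm]

theorem noiseExp_sum {α : Type*} (s : Finset α) (F : α → (ι → ZMod 2) → ℝ) :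
    noiseExp p (fun z => ∑ a ∈ s, F a z) = ∑ a ∈ s, noiseExp p (F a) := by
  simp only [noiseExp, mul_sum]
  exact sum_comm

theorem noiseExp_mul_sq_le (hp0 : 0 < p) (hp1 : p < 1) (F G : (ι → ZMod 2) → ℝ) :
    noiseExp p (fun z => F z * G z) ^ 2 ≤
      noiseExp p (fun z => F z ^ 2) * noiseExp p (fun z => G z ^ 2) := by
  unfold noiseExp
  refine sum_sq_le_sum_mul_sum_of_sq_le_mul _ (fun z _ => ?_) (fun z _ => ?_)
    (fun z _ => le_of_eq (by ring))
  · exact mul_nonneg (noiseWeight_nonneg hp0 hp1 z) (sq_nonneg _)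
  · exact mul_nonneg (noiseWeight_nonneg hp0 hp1 z) (sq_nonneg _)

theorem noiseExp_prod (f : ι → ZMod 2 → ℝ) :
    noiseExp p (fun z => ∏ i, f i (z i)) = ∏ i, ((1 - p) * f i 0 + p * f i 1) := by
  have h : ∀ i, (1 - p) * f i 0 + p * f i 1 = ∑ b, bscProb p 0 b * f i b := fun i => by
    rw [sum_zmod_two]; simp
  simp only [h, noiseExp, ← prod_mul_distrib]
  rw [prod_univ_sum, Fintype.piFinset_univ]

theorem noiseExp_one : noiseExp p (fun _ : ι → ZMod 2 => 1) = 1 := by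
  simpa using noiseExp_prod (p := p) (fun (_ : ι) _ => 1)

theorem noiseExp_comp_equiv {κ : Type*} [Fintype κ] [DecidableEq κ] (σ : κ ≃ ι)
    (F : (κ → ZMod 2) → ℝ) : noiseExp p (fun z : ι → ZMod 2 => F (z ∘ σ)) = noiseExp p F := by
  unfold noiseExp
  refine Fintype.sum_equiv (σ.symm.arrowCongr (Equiv.refl _)) _ _ fun z => ?_
  have h1 : σ.symm.arrowCongr (Equiv.refl _) z = z ∘ σ := by
    ext i; simp [Equiv.arrowCongr]
  rw [h1]
  congr 1
  exact (Fintype.prod_equiv σ _ _ fun i => rfl).symm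

/-- Resampling one coordinate does not change the expectation. -/
theorem noiseExp_resample (i : ι) (F : (ι → ZMod 2) → ℝ) :
    noiseExp p F = noiseExp p fun z =>
      (1 - p) * F (Function.update z i 0) + p * F (Function.update z i 1) := by
  have hw : ∀ (z : ι → ZMod 2) (b : ZMod 2),
      (∏ j, bscProb p 0 (Function.update z i b j)) * bscProb p 0 (z i) =
        (∏ j, bscProb p 0 (z j)) * bscProb p 0 b := by
    intro z b
    rw [← mul_prod_erase univ _ (mem_univ i),
      ← mul_prod_erase univ (fun j => bscProb p 0 (z j)) (mem_univ i)]
    have : ∏ j ∈ univ.erase i, bscProb p 0 (Function.update z i b j) =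
        ∏ j ∈ univ.erase i, bscProb p 0 (z j) :=
      prod_congr rfl fun j hj => by rw [Function.update_of_ne (ne_of_mem_erase hj)]
    rw [this, Function.update_self]
    ring
  have h1 : noiseExp p F = ∑ zb : (ι → ZMod 2) × ZMod 2,
      (∏ j, bscProb p 0 (zb.1 j)) * bscProb p 0 zb.2 * F zb.1 := by
    rw [Fintype.sum_prod_type]
    refine sum_congr rfl fun z _ => ?_
    rw [sum_zmod_two]; simp; ring
  have h2 : (noiseExp p fun z =>
      (1 - p) * F (Function.update z i 0) + p * F (Function.update z i 1)) =
      ∑ zb : (ι → ZMod 2) × ZMod 2,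
        (∏ j, bscProb p 0 (zb.1 j)) * bscProb p 0 zb.2 * F (Function.update zb.1 i zb.2) := by
    rw [Fintype.sum_prod_type]
    refine sum_congr rfl fun z _ => ?_
    rw [sum_zmod_two]; simp; ring
  rw [h1, h2]
  -- Swapping coordinate `i` with an independent fresh bit is an involution that preserves the
  -- product measure (`hw`).
  have hinv : Function.Involutive fun zb : (ι → ZMod 2) × ZMod 2 =>
      (Function.update zb.1 i zb.2, zb.1 i) := by
    rintro ⟨z, b⟩; simp
  refine Fintype.sum_equiv hinv.toPerm _ _ fun zb => ?_
  simp [hw]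

theorem biasedSign_mean (hp0 : 0 < p) (hp1 : p < 1) :
    (1 - p) * biasedSign p 0 + p * biasedSign p 1 = 0 := by
  have hq : 0 < 1 - p := by linarith
  have h1 := Real.sq_sqrt hp0.le
  have h2 := Real.sq_sqrt hq.le
  have h3 : 0 < √p := Real.sqrt_pos.2 hp0
  have h4 : 0 < √(1 - p) := Real.sqrt_pos.2 hq
  simp only [biasedSign, if_true, one_ne_zero, if_false, Real.sqrt_div hp0.le,
    Real.sqrt_div hq.le]
  field_simp
  rw [h1, h2]
  ring

theorem biasedSign_sq_zero (hp0 : 0 < p) (hp1 : p < 1) :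
    biasedSign p 0 ^ 2 = p / (1 - p) := by
  have hq : 0 < 1 - p := by linarith
  simp [biasedSign, Real.sq_sqrt (div_pos hp0 hq).le]

theorem biasedSign_sq_one (hp0 : 0 < p) (hp1 : p < 1) :
    biasedSign p 1 ^ 2 = (1 - p) / p := by
  have hq : 0 < 1 - p := by linarith
  simp [biasedSign, Real.sq_sqrt (div_pos hq hp0).le]

theorem biasedSign_zero_mul_one (hp0 : 0 < p) (hp1 : p < 1) :
    biasedSign p 0 * biasedSign p 1 = -1 := by
  have hq : 0 < 1 - p := by linarith
  have h3 : 0 < √p := Real.sqrt_pos.2 hp0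
  have h4 : 0 < √(1 - p) := Real.sqrt_pos.2 hq
  simp only [biasedSign, if_true, one_ne_zero, if_false, Real.sqrt_div hp0.le,
    Real.sqrt_div hq.le]
  field_simp

theorem biasedSign_var (hp0 : 0 < p) (hp1 : p < 1) :
    (1 - p) * biasedSign p 0 ^ 2 + p * biasedSign p 1 ^ 2 = 1 := by
  have hq : 0 < 1 - p := by linarith
  rw [biasedSign_sq_zero hp0 hp1, biasedSign_sq_one hp0 hp1]
  field_simp
  ring

theorem biasedChar_eq_prod (S : Finset ι) (z : ι → ZMod 2) :
    biasedChar p S z = ∏ i, if i ∈ S then biasedSign p (z i) else 1 := by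
  rw [biasedChar, prod_ite_mem, univ_inter]

theorem noiseExp_biasedChar_mul (hp0 : 0 < p) (hp1 : p < 1) (S T : Finset ι) :
    noiseExp p (fun z => biasedChar p S z * biasedChar p T z) = if S = T then 1 else 0 := by
  simp only [biasedChar_eq_prod, ← prod_mul_distrib]
  rw [noiseExp_prod (fun i b => (if i ∈ S then biasedSign p b else 1) *
    (if i ∈ T then biasedSign p b else 1))]
  have hm := biasedSign_mean hp0 hp1
  have hv := biasedSign_var hp0 hp1
  split_ifs with h
  · subst h
    refine prod_eq_one fun i _ => ?_
    split_ifs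
    · linear_combination hv
    · ring
  · obtain ⟨i, hi⟩ : ∃ i, ¬(i ∈ S ↔ i ∈ T) := by
      by_contra hc; push Not at hc; exact h (Finset.ext hc)
    refine prod_eq_zero (mem_univ i) ?_
    by_cases hS : i ∈ S <;> by_cases hT : i ∈ T <;> simp_all

/-- Completeness of the characters: the sum factors over coordinates as `∏ (1 + φ(y_i) φ(z_i))`, and
a factor with `y_i ≠ z_i` vanishes because the two values of `φ` have product `-1`. -/
theorem sum_biasedChar_mul (hp0 : 0 < p) (hp1 : p < 1) (y z : ι → ZMod 2) :
    (∏ i, bscProb p 0 (y i)) * ∑ S, biasedChar p S y * biasedChar p S z =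
      if y = z then 1 else 0 := by
  have hq : 0 < 1 - p := by linarith
  have h0 := biasedSign_sq_zero hp0 hp1
  have h1 := biasedSign_sq_one hp0 hp1
  have h01 := biasedSign_zero_mul_one hp0 hp1
  have : ∑ S, biasedChar p S y * biasedChar p S z =
      ∏ i, (1 + biasedSign p (y i) * biasedSign p (z i)) := by
    rw [prod_one_add, powerset_univ]
    simp only [biasedChar, prod_mul_distrib]
  rw [this, ← prod_mul_distrib]
  have key : ∀ a b : ZMod 2, bscProb p 0 a * (1 + biasedSign p a * biasedSign p b) =
      if a = b then 1 else 0 := by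
    intro a b
    rcases zmod_two_eq_zero_or_one a with rfl | rfl <;>
    rcases zmod_two_eq_zero_or_one b with rfl | rfl
    · rw [← sq, h0]; simp; field_simp; ring
    · simp [h01]
    · rw [mul_comm (biasedSign p 1), h01]; simp
    · rw [← sq, h1]; simp; field_simp; ring
  simp only [key]
  split_ifs with h
  · subst h; simp
  · obtain ⟨i, hi⟩ := Function.ne_iff.1 h
    exact prod_eq_zero (mem_univ i) (by simp [hi])

/-- Fourier inversion. -/
theorem sum_biasedCoeff_mul_biasedChar (hp0 : 0 < p) (hp1 : p < 1) (F : (ι → ZMod 2) → ℝ)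
    (z : ι → ZMod 2) : ∑ S, biasedCoeff p F S * biasedChar p S z = F z := by
  have : ∀ S, biasedCoeff p F S * biasedChar p S z =
      ∑ y, F y * ((∏ i, bscProb p 0 (y i)) * (biasedChar p S y * biasedChar p S z)) := by
    intro S
    rw [biasedCoeff, noiseExp, sum_mul]
    exact sum_congr rfl fun y _ => by ring
  simp only [this]
  rw [sum_comm]
  simp only [← mul_sum, sum_biasedChar_mul hp0 hp1]
  simp

/-- Parseval's identity. -/
theorem sum_biasedCoeff_sq (hp0 : 0 < p) (hp1 : p < 1) (F : (ι → ZMod 2) → ℝ) :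
    ∑ S, biasedCoeff p F S ^ 2 = noiseExp p fun z => F z ^ 2 := by
  have h : ∀ z, F z ^ 2 = ∑ S, biasedCoeff p F S * (F z * biasedChar p S z) := by
    intro z
    rw [sq]
    nth_rewrite 2 [← sum_biasedCoeff_mul_biasedChar hp0 hp1 F z]
    rw [mul_sum]
    exact sum_congr rfl fun S _ => by ring
  simp only [h, noiseExp_sum, noiseExp_const_mul]
  exact sum_congr rfl fun S _ => sq _

/-- The correlation of `F` evaluated on two sets of bits that overlap in `K` only is at most the
Fourier weight of `F` on the subsets of `K`. -/
theorem noiseExp_comp_mul_comp {κ : Type*} [Fintype κ] [DecidableEq κ] (hp0 : 0 < p) (hp1 : p < 1)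
    (F : (κ → ZMod 2) → ℝ) (e₁ e₂ : κ ↪ ι) (K : Finset κ)
    (hK : ∀ a b, e₁ a = e₂ b → a = b ∧ a ∈ K) :
    noiseExp p (fun z => F (z ∘ e₁) * F (z ∘ e₂)) ≤
      ∑ S ∈ K.powerset, biasedCoeff p F S ^ 2 := by
  have hchar : ∀ (e : κ ↪ ι) (S : Finset κ) (z : ι → ZMod 2),
      biasedChar p S (z ∘ e) = biasedChar p (S.map e) z := fun e S z => by
    simp [biasedChar]
  have hmul : ∀ z : ι → ZMod 2, F (z ∘ e₁) * F (z ∘ e₂) = ∑ S, ∑ T,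
      biasedCoeff p F S * biasedCoeff p F T *
        (biasedChar p (S.map e₁) z * biasedChar p (T.map e₂) z) := by
    intro z
    rw [← sum_biasedCoeff_mul_biasedChar hp0 hp1 F (z ∘ e₁),
      ← sum_biasedCoeff_mul_biasedChar hp0 hp1 F (z ∘ e₂), sum_mul_sum]
    refine sum_congr rfl fun S _ => sum_congr rfl fun T _ => ?_
    rw [hchar, hchar]; ring
  simp only [hmul, noiseExp_sum, noiseExp_const_mul, noiseExp_biasedChar_mul hp0 hp1]
  rw [← sum_filter_add_sum_filter_not univ (fun S : Finset κ => S ⊆ K)]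
  -- By orthogonality only pairs with equal images survive; the overlap hypothesis makes them
  -- diagonal and supported in `K`.
  have himp : ∀ S T : Finset κ, S.map e₁ = T.map e₂ → S = T ∧ S ⊆ K := by
    intro S T h
    have h1 : ∀ a ∈ S, a ∈ T ∧ a ∈ K := by
      intro a ha
      have : e₁ a ∈ T.map e₂ := h ▸ mem_map_of_mem _ ha
      obtain ⟨b, hb, hab⟩ := mem_map.1 this
      obtain ⟨rfl, hk⟩ := hK a b hab.symm
      exact ⟨hb, hk⟩
    have h2 : ∀ b ∈ T, b ∈ S := by
      intro b hb
      have : e₂ b ∈ S.map e₁ := h ▸ mem_map_of_mem _ hb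
      obtain ⟨a, ha, hab⟩ := mem_map.1 this
      obtain ⟨rfl, -⟩ := hK a b hab
      exact ha
    exact ⟨Finset.ext fun a => ⟨fun ha => (h1 a ha).1, h2 a⟩, fun a ha => (h1 a ha).2⟩
  have hz : ∑ S with ¬ S ⊆ K, ∑ T, biasedCoeff p F S * biasedCoeff p F T *
      (if S.map e₁ = T.map e₂ then (1 : ℝ) else 0) = 0 := by
    refine sum_eq_zero fun S hS => sum_eq_zero fun T _ => ?_
    rw [if_neg fun h => (mem_filter.1 hS).2 (himp S T h).2, mul_zero]
  rw [hz, add_zero]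
  have hf : univ.filter (fun S : Finset κ => S ⊆ K) = K.powerset := by
    ext S; simp
  rw [hf]
  refine sum_le_sum fun S _ => ?_
  rw [sum_eq_single S]
  -- The embeddings need not agree on `K`, so a diagonal term may vanish; this is why only an
  -- inequality holds.
  · split_ifs
    · rw [mul_one, sq]
    · rw [mul_zero]; exact sq_nonneg _
  · intro T _ hT
    rw [if_neg fun h => hT (himp S T h).1.symm, mul_zero]
  · simp

/-- The noise is i.i.d., so a coordinate symmetry of `F` is a symmetry of its spectrum. -/
theorem biasedCoeff_map_equiv (σ : ι ≃ ι) {F : (ι → ZMod 2) → ℝ} (hF : ∀ z, F (z ∘ σ) = F z)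
    (S : Finset ι) : biasedCoeff p F (S.map σ.toEmbedding) = biasedCoeff p F S := by
  unfold biasedCoeff
  rw [← noiseExp_comp_equiv σ fun z => F z * biasedChar p S z]
  congr 1
  funext z
  rw [hF]
  simp [biasedChar]

/-! ### Hypercontractivity and the level inequality. -/

/-- Fourth moment of `d φ + e` for a normalized biased bit `φ`. -/
theorem biasedSign_fourth_moment_le (hp0 : 0 < p) (hp1 : p < 1) (d e : ℝ) :
    (1 - p) * (biasedSign p 0 * d + e) ^ 4 + p * (biasedSign p 1 * d + e) ^ 4 ≤
      9 / min p (1 - p) * d ^ 4 + 8 * (d ^ 2 * e ^ 2) + e ^ 4 := by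
  have hq : 0 < 1 - p := by linarith
  have hm := biasedSign_mean hp0 hp1
  have hv := biasedSign_var hp0 hp1
  have h0 := biasedSign_sq_zero hp0 hp1
  have h1 := biasedSign_sq_one hp0 hp1
  have h01 := biasedSign_zero_mul_one hp0 hp1
  set u := biasedSign p 0
  set v := biasedSign p 1
  -- `v² = 1 + (u + v) v`, so that the third moment is `u + v`
  set t := u + v with ht
  set K := 1 / (p * (1 - p)) with hK
  have ht2 : t ^ 2 = K - 4 := by
    have : t ^ 2 = u ^ 2 + 2 * (u * v) + v ^ 2 := by rw [ht]; ring
    rw [this, h0, h1, h01, hK]; field_simp; ring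
  have h3 : (1 - p) * u ^ 3 + p * v ^ 3 = t := by
    have e1 : (1 - p) * u ^ 3 + p * v ^ 3 = ((1 - p) * u ^ 2) * u + (p * v ^ 2) * v := by ring
    have e2 : (1 - p) * u ^ 2 = p := by rw [h0]; field_simp
    have e3 : p * v ^ 2 = 1 - p := by rw [h1]; field_simp
    rw [e1, e2, e3, ht]; linarith
  have h4 : (1 - p) * u ^ 4 + p * v ^ 4 = K - 3 := by
    have e1 : (1 - p) * u ^ 4 + p * v ^ 4 = (1 - p) * (u ^ 2) ^ 2 + p * (v ^ 2) ^ 2 := by ring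
    rw [e1, h0, h1, hK]; field_simp; ring
  have hexp : (1 - p) * (u * d + e) ^ 4 + p * (v * d + e) ^ 4 =
      ((1 - p) * u ^ 4 + p * v ^ 4) * d ^ 4 + 4 * ((1 - p) * u ^ 3 + p * v ^ 3) * d ^ 3 * e +
      6 * ((1 - p) * u ^ 2 + p * v ^ 2) * d ^ 2 * e ^ 2 +
      4 * ((1 - p) * u + p * v) * d * e ^ 3 + e ^ 4 := by ring
  rw [hexp, hm, hv, h3, h4]
  -- The larger of `p` and `1 - p` is at least `1/2`, so already `3 K ≤ 6 / min p (1 - p)`.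
  have hKle : 3 * K ≤ 9 / min p (1 - p) := by
    rw [hK]
    rcases min_cases p (1 - p) with ⟨h, h'⟩ | ⟨h, h'⟩ <;> rw [h, mul_one_div] <;>
    · rw [div_le_div_iff₀ (by positivity) (by positivity)]
      nlinarith [mul_pos hp0 hq]
  have hsq := sq_nonneg (t * d - e)
  have hd : 0 ≤ d ^ 2 := sq_nonneg d
  -- AM-GM absorbs the third-moment term. The coefficient of `d⁴` becomes `(K - 3) + 2 (K - 4) ≤ 3
  -- K`, and that of `d² e²` becomes `6 + 2 = 8`.
  have hs : 4 * t * d ^ 3 * e ≤ 2 * t ^ 2 * d ^ 4 + 2 * d ^ 2 * e ^ 2 := by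
    nlinarith [mul_nonneg hd hsq]
  rw [ht2] at hs
  nlinarith [mul_le_mul_of_nonneg_right hKle (pow_nonneg hd 2)]

/-- Biased `(2, 4)`-hypercontractivity. -/
theorem noiseExp_sum_biasedChar_pow_four_le (hp0 : 0 < p) (hp1 : p < 1) {r : ℝ} (hr : 4 ≤ r)
    (hr2 : 9 / min p (1 - p) ≤ r ^ 2) (I : Finset ι) (a : Finset ι → ℝ) :
    noiseExp p (fun z => (∑ S ∈ I.powerset, a S * biasedChar p S z) ^ 4) ≤
      (∑ S ∈ I.powerset, r ^ S.card * a S ^ 2) ^ 2 := by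
  induction I using Finset.induction_on generalizing a with
  | empty =>
    simp only [powerset_empty, sum_singleton, biasedChar, prod_empty, card_empty, pow_zero, one_mul]
    have := noiseExp_const_mul (p := p) ((a ∅ * 1) ^ 4) (fun _ : ι → ZMod 2 => 1)
    simp only [mul_one, noiseExp_one] at this ⊢
    rw [this]
    apply le_of_eq; ring
  | insert i I hi ih =>
    -- The polynomial is `φ(z_i) d + e` with `d` and `e` independent of `z_i`, so the one-bit
    -- estimate applies conditionally on the other bits.
    set d : (ι → ZMod 2) → ℝ := fun z => ∑ S ∈ I.powerset, a (insert i S) * biasedChar p S z with hd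
    set e : (ι → ZMod 2) → ℝ := fun z => ∑ S ∈ I.powerset, a S * biasedChar p S z with he
    have hmem : ∀ S ∈ I.powerset, i ∉ S := fun S hS h => hi (mem_powerset.1 hS h)
    have hdec : ∀ z, ∑ S ∈ (insert i I).powerset, a S * biasedChar p S z =
        biasedSign p (z i) * d z + e z := by
      intro z
      rw [sum_powerset_insert hi, add_comm, hd, mul_sum]
      congr 1
      refine sum_congr rfl fun S hS => ?_
      rw [biasedChar, prod_insert (hmem S hS), biasedChar]; ring
    have hcu : ∀ S ∈ I.powerset, ∀ z b, biasedChar p S (Function.update z i b) =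
        biasedChar p S z := by
      intro S hS z b
      refine prod_congr rfl fun j hj => ?_
      rw [Function.update_of_ne]
      rintro rfl
      exact hmem S hS hj
    have hdu : ∀ z b, d (Function.update z i b) = d z := fun z b =>
      sum_congr rfl fun S hS => by rw [hcu S hS]
    have heu : ∀ z b, e (Function.update z i b) = e z := fun z b =>
      sum_congr rfl fun S hS => by rw [hcu S hS]
    set D := ∑ S ∈ I.powerset, r ^ S.card * a (insert i S) ^ 2 with hD
    set E := ∑ S ∈ I.powerset, r ^ S.card * a S ^ 2 with hE
    have hr0 : 0 ≤ r := by linarith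
    have hD0 : 0 ≤ D := sum_nonneg fun S _ => by positivity
    have hE0 : 0 ≤ E := sum_nonneg fun S _ => by positivity
    have hsum : ∑ S ∈ (insert i I).powerset, r ^ S.card * a S ^ 2 = E + r * D := by
      rw [sum_powerset_insert hi, hD, mul_sum]
      congr 1
      refine sum_congr rfl fun S hS => ?_
      rw [card_insert_of_notMem (hmem S hS)]; ring
    have hd4 : noiseExp p (fun z => d z ^ 4) ≤ D ^ 2 := ih fun S => a (insert i S)
    have he4 : noiseExp p (fun z => e z ^ 4) ≤ E ^ 2 := ih a
    have hde : noiseExp p (fun z => d z ^ 2 * e z ^ 2) ≤ D * E := by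
      have h := noiseExp_mul_sq_le hp0 hp1 (fun z => d z ^ 2) (fun z => e z ^ 2)
      simp only [← pow_mul, Nat.reduceMul] at h
      refine abs_le_of_sq_le_sq' ?_ (mul_nonneg hD0 hE0) |>.2
      calc _ ≤ _ := h
        _ ≤ D ^ 2 * E ^ 2 := mul_le_mul hd4 he4
            (noiseExp_nonneg hp0 hp1 fun z => by positivity) (by positivity)
        _ = _ := by ring
    simp only [hdec, hsum]
    rw [noiseExp_resample i]
    simp only [hdu, heu, Function.update_self]
    calc _ ≤ noiseExp p (fun z => 9 / min p (1 - p) * d z ^ 4 + 8 * (d z ^ 2 * e z ^ 2) + e z ^ 4) :=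
          noiseExp_mono hp0 hp1 fun z => biasedSign_fourth_moment_le hp0 hp1 (d z) (e z)
      _ = 9 / min p (1 - p) * noiseExp p (fun z => d z ^ 4) +
          8 * noiseExp p (fun z => d z ^ 2 * e z ^ 2) + noiseExp p (fun z => e z ^ 4) := by
          rw [noiseExp_add, noiseExp_add, noiseExp_const_mul, noiseExp_const_mul]
      _ ≤ r ^ 2 * D ^ 2 + 8 * (D * E) + E ^ 2 := by
          gcongr
          exact noiseExp_nonneg hp0 hp1 fun z => by positivity
      -- The cross term needs `8 ≤ 2 r`, which is the role of `4 ≤ r`.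
      _ ≤ (E + r * D) ^ 2 := by
          nlinarith [mul_nonneg hD0 hE0]

/-- The level inequality for `[0, 1]`-valued functions, in terms of the mean. -/
theorem sum_biasedCoeff_sq_low_degree_le (hp0 : 0 < p) (hp1 : p < 1) {F : (ι → ZMod 2) → ℝ}
    (hF0 : ∀ z, 0 ≤ F z) (hF1 : ∀ z, F z ≤ 1) (k : ℕ) :
    (∑ S with S.card ≤ k, biasedCoeff p F S ^ 2) ^ 2 ≤
      noiseExp p F ^ 3 * (9 / min p (1 - p)) ^ k := by
  have hlam : 0 < min p (1 - p) := lt_min hp0 (by linarith)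
  have hlam2 : min p (1 - p) ≤ 1 / 2 := by
    rcases min_cases p (1 - p) with ⟨h, h'⟩ | ⟨h, h'⟩ <;> linarith
  set M := 9 / min p (1 - p) with hM
  have hM16 : 16 ≤ M := by
    rw [hM, le_div_iff₀ hlam]; linarith
  set r := √M with hr
  have hr2 : r ^ 2 = M := Real.sq_sqrt (by linarith)
  have hr0 : 0 ≤ r := Real.sqrt_nonneg _
  have hr4 : 4 ≤ r := Real.le_sqrt_of_sq_le (by linarith)
  set W := ∑ S with S.card ≤ k, biasedCoeff p F S ^ 2 with hW
  set P := noiseExp p F with hP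
  have hP0 : 0 ≤ P := noiseExp_nonneg hp0 hp1 hF0
  have hW0 : 0 ≤ W := sum_nonneg fun S _ => sq_nonneg _
  set a : Finset ι → ℝ := fun S => if S.card ≤ k then biasedCoeff p F S else 0 with ha
  -- `g` is the truncation of `F` to degree at most `k`, so that `W = E[F g]`.
  set g : (ι → ZMod 2) → ℝ := fun z => ∑ S ∈ univ.powerset, a S * biasedChar p S z with hg
  have hg4 : noiseExp p (fun z => g z ^ 4) ≤ (r ^ k * W) ^ 2 := by
    refine (noiseExp_sum_biasedChar_pow_four_le hp0 hp1 hr4 hr2.ge univ a).trans ?_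
    refine pow_le_pow_left₀ (sum_nonneg fun S _ => by positivity) ?_ 2
    rw [hW, mul_sum, sum_filter, powerset_univ]
    refine sum_le_sum fun S _ => ?_
    simp only [ha]
    split_ifs with h
    · gcongr; linarith
    · simp
  have hWg : W = noiseExp p (fun z => F z * g z) := by
    simp only [hg, mul_sum, mul_left_comm (F _), noiseExp_sum, noiseExp_const_mul]
    rw [hW, sum_filter, powerset_univ]
    refine sum_congr rfl fun S _ => ?_
    simp only [ha]
    split_ifs
    · exact sq _
    · simp
  -- Two applications of Cauchy–Schwarz play the role of Hölder with exponents `4/3` and `4`: `W⁴ ≤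
  -- P³ E[g⁴]`. Hypercontractivity bounds `E[g⁴]` by `M^k W²`, and `W²` cancels.
  have h1 : W ^ 2 ≤ P * noiseExp p (fun z => F z * g z ^ 2) := by
    have h := noiseExp_mul_sq_le hp0 hp1 (fun z => √(F z)) (fun z => √(F z) * g z)
    have e1 : ∀ z, √(F z) * (√(F z) * g z) = F z * g z := fun z => by
      rw [← mul_assoc, Real.mul_self_sqrt (hF0 z)]
    have e2 : ∀ z, √(F z) ^ 2 = F z := fun z => Real.sq_sqrt (hF0 z)
    simp only [mul_pow, e1, e2] at h
    rw [hWg]; exact h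
  have h2 : noiseExp p (fun z => F z * g z ^ 2) ^ 2 ≤ P * (r ^ k * W) ^ 2 := by
    have h := noiseExp_mul_sq_le hp0 hp1 F (fun z => g z ^ 2)
    simp only [← pow_mul, Nat.reduceMul] at h
    refine h.trans (mul_le_mul ?_ hg4 (noiseExp_nonneg hp0 hp1 fun z => by positivity) hP0)
    exact noiseExp_mono hp0 hp1 fun z => by nlinarith [hF0 z, hF1 z]
  have h3 : W ^ 2 * W ^ 2 ≤ W ^ 2 * (P ^ 3 * M ^ k) := by
    have hQ : 0 ≤ noiseExp p (fun z => F z * g z ^ 2) :=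
      noiseExp_nonneg hp0 hp1 fun z => mul_nonneg (hF0 z) (sq_nonneg _)
    calc W ^ 2 * W ^ 2 ≤ (P * noiseExp p (fun z => F z * g z ^ 2)) *
          (P * noiseExp p (fun z => F z * g z ^ 2)) :=
          mul_le_mul h1 h1 (sq_nonneg _) (mul_nonneg hP0 hQ)
      _ = P ^ 2 * noiseExp p (fun z => F z * g z ^ 2) ^ 2 := by ring
      _ ≤ P ^ 2 * (P * (r ^ k * W) ^ 2) := by gcongr
      _ = W ^ 2 * (P ^ 3 * M ^ k) := by rw [← hr2]; ring
  rcases hW0.eq_or_lt with h | h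
  · rw [← h, zero_pow two_ne_zero]; positivity
  · exact le_of_mul_le_mul_left h3 (by positivity)

end BiasedFourier

/-! ### Equivariant decoders and majority voting. -/

section Decoding

variable {ι : Type*} [Fintype ι] [DecidableEq ι] {p : ℝ}

/-- A (randomized) decoder of bit `i₀`, given by the probability `h y` of the output `1`, that
commutes with adding codewords to the observation. -/
def IsEquivariantDecoder (C : Submodule (ZMod 2) (ι → ZMod 2)) (i₀ : ι)
    (h : ({i : ι // i ≠ i₀} → ZMod 2) → ℝ) : Prop :=
  ∀ x ∈ C, ∀ y, h (fun i => y i + x i) = if x i₀ = 0 then h y else 1 - h y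

/-- The probability that the bit-MAP decoder with uniform tie-breaking outputs `1`. -/
noncomputable def softMAP (p : ℝ) (C : Submodule (ZMod 2) (ι → ZMod 2)) (i₀ : ι)
    (y : {i : ι // i ≠ i₀} → ZMod 2) : ℝ :=
  if extrinsicJointProb p C i₀ 0 y < extrinsicJointProb p C i₀ 1 y then 1
  else if extrinsicJointProb p C i₀ 1 y < extrinsicJointProb p C i₀ 0 y then 0 else 1 / 2

theorem bscProb_eq_zero_add (p : ℝ) (x y : ZMod 2) : bscProb p x y = bscProb p 0 (y + x) := by
  have : ∀ x y : ZMod 2, y = x ↔ y + x = 0 := by decide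
  unfold bscProb
  exact if_congr (this x y) rfl rfl

open Classical in
theorem extrinsicJointProb_eq_sum_ite (C : Submodule (ZMod 2) (ι → ZMod 2)) (i₀ : ι) (b : ZMod 2)
    (y : {i : ι // i ≠ i₀} → ZMod 2) :
    extrinsicJointProb p C i₀ b y = ∑ x : ι → ZMod 2, if x ∈ C ∧ x i₀ = b then
      (Nat.card C : ℝ)⁻¹ * ∏ i : {i : ι // i ≠ i₀}, bscProb p 0 (y i + x i) else 0 := by
  rw [extrinsicJointProb, sum_filter]
  simp only [bscProb_eq_zero_add p _ (y _)]

theorem extrinsicJointProb_add (C : Submodule (ZMod 2) (ι → ZMod 2)) (i₀ : ι) (b : ZMod 2)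
    (y : {i : ι // i ≠ i₀} → ZMod 2) {c : ι → ZMod 2} (hc : c ∈ C) :
    extrinsicJointProb p C i₀ (b + c i₀) (fun i => y i + c i) = extrinsicJointProb p C i₀ b y := by
  rw [extrinsicJointProb_eq_sum_ite, extrinsicJointProb_eq_sum_ite]
  refine Fintype.sum_equiv (Equiv.addRight c) _ _ fun x => ?_
  have h1 : x + c ∈ C ↔ x ∈ C := Submodule.add_mem_iff_left C hc
  have h2 : ∀ u v w : ZMod 2, u + w = v ↔ u = v + w := by decide
  refine @if_congr _ _ _ (_) (_) _ _ _ _ (and_congr h1.symm (h2 _ _ _).symm) ?_ rfl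
  simp only [Equiv.coe_addRight, Pi.add_apply, add_assoc, add_comm (x _) (c _)]

/-- The zero word and the all-ones word realize both values of bit `i₀`, so neither sum is empty.
This makes `ln P` and division by it meaningful later. -/
theorem extrinsicJointProb_pos (hp0 : 0 < p) (hp1 : p < 1) {C : Submodule (ZMod 2) (ι → ZMod 2)}
    (h1 : (fun _ => 1) ∈ C) (i₀ : ι) (b : ZMod 2) (y : {i : ι // i ≠ i₀} → ZMod 2) :
    0 < extrinsicJointProb p C i₀ b y := by
  classical
  have hC : (0 : ℝ) < Nat.card C := by exact_mod_cast Nat.card_pos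
  refine sum_pos (fun x _ => ?_) ?_
  · exact mul_pos (inv_pos.2 hC) (prod_pos fun i _ => bscProb_pos hp0 hp1 _ _)
  · rcases zmod_two_eq_zero_or_one b with rfl | rfl
    · exact ⟨0, by simp⟩
    · exact ⟨fun _ => 1, by simpa using h1⟩

/-- A codeword with value `1` at `i₀` exchanges the two joint probabilities. A fixed preference at
ties need not respect this, whereas `1/2` is fixed by `t ↦ 1 - t`. -/
theorem isEquivariantDecoder_softMAP (C : Submodule (ZMod 2) (ι → ZMod 2)) (i₀ : ι) :
    IsEquivariantDecoder C i₀ (softMAP p C i₀) := by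
  intro x hx y
  have h0 := extrinsicJointProb_add (p := p) C i₀ 0 y hx
  have h1 := extrinsicJointProb_add (p := p) C i₀ 1 y hx
  rcases zmod_two_eq_zero_or_one (x i₀) with h | h
  · rw [h, add_zero] at h0 h1
    rw [if_pos h, softMAP, h0, h1, softMAP]
  · have e : (1 : ZMod 2) + 1 = 0 := by decide
    rw [h, zero_add] at h0
    rw [h, e] at h1
    rw [h, if_neg one_ne_zero, softMAP, h0, h1, softMAP]
    split_ifs with h2 h3
    · exact absurd h2 h3.not_gt
    all_goals norm_num

theorem softMAP_mem_Icc (C : Submodule (ZMod 2) (ι → ZMod 2)) (i₀ : ι)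
    (y : {i : ι // i ≠ i₀} → ZMod 2) : softMAP p C i₀ y ∈ Set.Icc (0 : ℝ) 1 := by
  unfold softMAP
  split_ifs <;> norm_num

/-- An equivariant decoder errs with the probability that it outputs `1` on pure noise. -/
theorem IsEquivariantDecoder.sum_joint_eq_noiseExp {C : Submodule (ZMod 2) (ι → ZMod 2)} {i₀ : ι}
    {h : ({i : ι // i ≠ i₀} → ZMod 2) → ℝ} (hh : IsEquivariantDecoder C i₀ h) :
    ∑ y, (extrinsicJointProb p C i₀ 0 y * h y + extrinsicJointProb p C i₀ 1 y * (1 - h y)) =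
      noiseExp p h := by
  classical
  have hy : ∀ y, extrinsicJointProb p C i₀ 0 y * h y + extrinsicJointProb p C i₀ 1 y * (1 - h y) =
      ∑ x with x ∈ C, (Nat.card C : ℝ)⁻¹ *
        ((∏ i : {i : ι // i ≠ i₀}, bscProb p 0 (y i + x i)) * h (fun i => y i + x i)) := by
    intro y
    rw [extrinsicJointProb_eq_sum_ite, extrinsicJointProb_eq_sum_ite, sum_mul, sum_mul,
      ← sum_add_distrib, sum_filter]
    refine sum_congr rfl fun x _ => ?_
    by_cases hx : x ∈ C
    · rw [hh x hx]
      rcases zmod_two_eq_zero_or_one (x i₀) with h0 | h0 <;> simp [hx, h0, mul_assoc]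
    · simp [hx]
  -- Translating `y` by `x` shows that every codeword contributes the same amount.
  have hx : ∀ x : ι → ZMod 2, ∑ y : {i : ι // i ≠ i₀} → ZMod 2,
      (∏ i : {i : ι // i ≠ i₀}, bscProb p 0 (y i + x i)) * h (fun i => y i + x i) =
        noiseExp p h := by
    intro x
    exact Fintype.sum_equiv (Equiv.addRight fun i : {i : ι // i ≠ i₀} => x i) _ _ fun y => rfl
  have hC : (Nat.card C : ℝ) ≠ 0 := by exact_mod_cast Nat.card_pos.ne'
  have hcard : (univ.filter fun x => x ∈ C).card = Nat.card C := by
    rw [Nat.card_eq_fintype_card, Fintype.card_subtype]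
  simp only [hy]
  rw [sum_comm]
  simp only [← mul_sum, hx]
  rw [sum_const, hcard, nsmul_eq_mul, ← mul_assoc, inv_mul_cancel₀ hC, one_mul]

theorem extrinsicBitErrorProb_eq_sum_min {C : Submodule (ZMod 2) (ι → ZMod 2)} {i₀ : ι}
    {g : ({i : ι // i ≠ i₀} → ZMod 2) → ZMod 2} (hg : IsExtrinsicBitMAP p C i₀ g) :
    extrinsicBitErrorProb p C i₀ g =
      ∑ y, min (extrinsicJointProb p C i₀ 0 y) (extrinsicJointProb p C i₀ 1 y) := by
  refine sum_congr rfl fun y => ?_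
  intro _
  rw [sum_filter, sum_zmod_two]
  have h0 := hg y 0
  have h1 := hg y 1
  rcases zmod_two_eq_zero_or_one (g y) with h | h <;> rw [h] at h0 h1 ⊢
  · simp [min_eq_right h1]
  · simp [min_eq_left h0]

/-- The bit-MAP decoder is at least as good as every equivariant decoder. -/
theorem extrinsicBitErrorProb_le_noiseExp {C : Submodule (ZMod 2) (ι → ZMod 2)} {i₀ : ι}
    {g : ({i : ι // i ≠ i₀} → ZMod 2) → ZMod 2} (hg : IsExtrinsicBitMAP p C i₀ g)
    {h : ({i : ι // i ≠ i₀} → ZMod 2) → ℝ} (hh : IsEquivariantDecoder C i₀ h)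
    (hI : ∀ y, h y ∈ Set.Icc (0 : ℝ) 1) : extrinsicBitErrorProb p C i₀ g ≤ noiseExp p h := by
  rw [extrinsicBitErrorProb_eq_sum_min hg, ← hh.sum_joint_eq_noiseExp]
  refine sum_le_sum fun y _ => ?_
  obtain ⟨h0, h1⟩ := hI y
  have a := mul_le_mul_of_nonneg_right (min_le_left (extrinsicJointProb p C i₀ 0 y)
    (extrinsicJointProb p C i₀ 1 y)) h0
  have b := mul_le_mul_of_nonneg_right (min_le_right (extrinsicJointProb p C i₀ 0 y)
    (extrinsicJointProb p C i₀ 1 y)) (sub_nonneg.2 h1)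
  linarith

/-- At a tie the two joint probabilities coincide, so averaging the two answers costs nothing. -/
theorem extrinsicBitErrorProb_eq_noiseExp_softMAP {C : Submodule (ZMod 2) (ι → ZMod 2)} {i₀ : ι}
    {g : ({i : ι // i ≠ i₀} → ZMod 2) → ZMod 2} (hg : IsExtrinsicBitMAP p C i₀ g) :
    extrinsicBitErrorProb p C i₀ g = noiseExp p (softMAP p C i₀) := by
  rw [extrinsicBitErrorProb_eq_sum_min hg,
    ← (isEquivariantDecoder_softMAP C i₀).sum_joint_eq_noiseExp]
  refine sum_congr rfl fun y _ => ?_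
  unfold softMAP
  split_ifs with h1 h2
  · rw [min_eq_left h1.le]; ring
  · rw [min_eq_right h2.le]; ring
  · rw [le_antisymm (not_lt.1 h1) (not_lt.1 h2), min_self]; ring

theorem extrinsicBitErrorProb_pos (hp0 : 0 < p) (hp1 : p < 1)
    {C : Submodule (ZMod 2) (ι → ZMod 2)} (h1 : (fun _ => 1) ∈ C) {i₀ : ι}
    {g : ({i : ι // i ≠ i₀} → ZMod 2) → ZMod 2} (hg : IsExtrinsicBitMAP p C i₀ g) :
    0 < extrinsicBitErrorProb p C i₀ g := by
  rw [extrinsicBitErrorProb_eq_sum_min hg]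
  exact sum_pos (fun y _ => lt_min (extrinsicJointProb_pos hp0 hp1 h1 _ _ _)
    (extrinsicJointProb_pos hp0 hp1 h1 _ _ _)) univ_nonempty

/-- A fair coin is an equivariant decoder. -/
theorem extrinsicBitErrorProb_le_half {C : Submodule (ZMod 2) (ι → ZMod 2)} {i₀ : ι}
    {g : ({i : ι // i ≠ i₀} → ZMod 2) → ZMod 2} (hg : IsExtrinsicBitMAP p C i₀ g) :
    extrinsicBitErrorProb p C i₀ g ≤ 1 / 2 := by
  have hh : IsEquivariantDecoder C i₀ fun _ => 1 / 2 := fun x _ y => by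
    split_ifs <;> norm_num
  refine (extrinsicBitErrorProb_le_noiseExp hg hh fun y => by norm_num).trans_eq ?_
  simpa [noiseExp_one] using noiseExp_const_mul (p := p) (1 / 2)
    (fun _ : {i : ι // i ≠ i₀} → ZMod 2 => 1)

/-- The relabelling of the non-distinguished positions induced by an injection. -/
def restrictNe {κ : Type*} (e : κ ↪ ι) {k₀ : κ} {i₀ : ι} (he : e k₀ = i₀) :
    {k : κ // k ≠ k₀} ↪ {i : ι // i ≠ i₀} where
  toFun k := ⟨e k, fun h => k.2 (e.injective (h.trans he.symm))⟩
  inj' _ _ h := Subtype.ext (e.injective (congrArg Subtype.val h))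

/-- Decoding three looks separately, followed by a majority vote. -/
theorem extrinsicBitErrorProb_le_of_three_looks (hp0 : 0 < p) (hp1 : p < 1)
    {κ : Type*} [Fintype κ] [DecidableEq κ]
    {C : Submodule (ZMod 2) (ι → ZMod 2)} {C' : Submodule (ZMod 2) (κ → ZMod 2)} {i₀ : ι} {k₀ : κ}
    {g : ({i : ι // i ≠ i₀} → ZMod 2) → ZMod 2} (hg : IsExtrinsicBitMAP p C i₀ g)
    {f : ({k : κ // k ≠ k₀} → ZMod 2) → ℝ} (hf : IsEquivariantDecoder C' k₀ f)
    (hI : ∀ y, f y ∈ Set.Icc (0 : ℝ) 1)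
    (e : Fin 3 → κ ↪ ι) (he : ∀ j, e j k₀ = i₀) (heC : ∀ j, ∀ x ∈ C, x ∘ e j ∈ C') {Q : ℝ}
    (hQ : ∀ i j, i ≠ j →
      noiseExp p (fun z => f (z ∘ restrictNe (e i) (he i)) * f (z ∘ restrictNe (e j) (he j))) ≤ Q) :
    extrinsicBitErrorProb p C i₀ g ≤ 3 * Q := by
  set F : Fin 3 → ({i : ι // i ≠ i₀} → ZMod 2) → ℝ := fun j z => f (z ∘ restrictNe (e j) (he j))
    with hF
  have hFI : ∀ j z, 0 ≤ F j z ∧ F j z ≤ 1 := fun j z => hI _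
  have hFe : ∀ j, IsEquivariantDecoder C i₀ (F j) := by
    intro j x hx y
    have := hf _ (heC j x hx) (y ∘ restrictNe (e j) (he j))
    simp only [Function.comp_apply, he] at this
    exact this
  -- The probability that a majority of three independent votes is `1`. This polynomial turns into
  -- `1 - h` when each vote `F j` turns into `1 - F j`, which gives both equivariance and, from `0 ≤
  -- h`, the bound `h ≤ 1`.
  set h : ({i : ι // i ≠ i₀} → ZMod 2) → ℝ := fun z =>
    F 0 z * F 1 z + F 0 z * F 2 z + F 1 z * F 2 z - 2 * F 0 z * F 1 z * F 2 z with hh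
  have hhe : IsEquivariantDecoder C i₀ h := by
    intro x hx y
    simp only [hh, hFe _ x hx y]
    split_ifs
    · rfl
    · ring
  have hhle : ∀ z, h z ≤ F 0 z * F 1 z + F 0 z * F 2 z + F 1 z * F 2 z := by
    intro z
    have := mul_nonneg (mul_nonneg (hFI 0 z).1 (hFI 1 z).1) (hFI 2 z).1
    simp only [hh]; linarith
  have hmaj : ∀ a b c : ℝ, 0 ≤ a → a ≤ 1 → 0 ≤ b → b ≤ 1 → 0 ≤ c → c ≤ 1 →
      0 ≤ a * b + a * c + b * c - 2 * a * b * c := by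
    intro a b c a0 a1 b0 b1 c0 c1
    have h1 := mul_nonneg (mul_nonneg a0 b0) (sub_nonneg.2 c1)
    have h2 := mul_nonneg (mul_nonneg a0 c0) (sub_nonneg.2 b1)
    have h3 := mul_nonneg b0 c0
    nlinarith
  have hhI : ∀ z, h z ∈ Set.Icc (0 : ℝ) 1 := by
    intro z
    obtain ⟨a0, a1⟩ := hFI 0 z
    obtain ⟨b0, b1⟩ := hFI 1 z
    obtain ⟨c0, c1⟩ := hFI 2 z
    refine ⟨hmaj _ _ _ a0 a1 b0 b1 c0 c1, ?_⟩
    have := hmaj (1 - F 0 z) (1 - F 1 z) (1 - F 2 z) (by linarith) (by linarith) (by linarith)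
      (by linarith) (by linarith) (by linarith)
    simp only [hh]
    linarith
  have h01 := hQ 0 1 (by decide)
  have h02 := hQ 0 2 (by decide)
  have h12 := hQ 1 2 (by decide)
  refine (extrinsicBitErrorProb_le_noiseExp hg hhe hhI).trans
    ((noiseExp_mono hp0 hp1 hhle).trans ?_)
  rw [noiseExp_add, noiseExp_add]
  simp only [hF]
  linarith

/-- The optimal decoder inherits the symmetries of the code. -/
theorem softMAP_comp_equiv {C : Submodule (ZMod 2) (ι → ZMod 2)} {i₀ : ι} (σ : ι ≃ ι)
    (h₀ : σ i₀ = i₀) (hσ : ∀ x, x ∘ σ ∈ C ↔ x ∈ C) (τ : {i : ι // i ≠ i₀} ≃ {i : ι // i ≠ i₀})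
    (hτ : ∀ i, (τ i : ι) = σ i) (y : {i : ι // i ≠ i₀} → ZMod 2) :
    softMAP p C i₀ (y ∘ τ) = softMAP p C i₀ y := by
  have h : ∀ b, extrinsicJointProb p C i₀ b (y ∘ τ) = extrinsicJointProb p C i₀ b y := by
    intro b
    rw [extrinsicJointProb_eq_sum_ite, extrinsicJointProb_eq_sum_ite]
    refine (Fintype.sum_equiv (σ.symm.arrowCongr (Equiv.refl _)) _ _ fun x => ?_).symm
    have h1 : σ.symm.arrowCongr (Equiv.refl _) x = x ∘ σ := by
      ext i; simp [Equiv.arrowCongr]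
    rw [h1]
    refine @if_congr _ _ _ (_) (_) _ _ _ _ (and_congr (hσ x).symm ?_) ?_ rfl
    · rw [Function.comp_apply, h₀]
    simp only [Function.comp_apply, ← hτ]
    rw [Fintype.prod_equiv τ _ (fun i => bscProb p 0 (y i + x i)) fun i => rfl]
  rw [softMAP, h, h, softMAP]

end Decoding

/-! ### Linear symmetries of Reed–Muller codes. -/

section ReedMuller

open MvPolynomial

theorem zmod_two_pow_min_one (x : ZMod 2) (n : ℕ) : x ^ min n 1 = x ^ n := by
  rcases n with _ | n
  · rfl
  · rcases zmod_two_eq_zero_or_one x with rfl | rfl <;> simp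

/-- Capping exponents at `1` changes no value over `𝔽₂` and does not raise the degree, so the
condition on individual degrees can be dropped. Substitutions then need only respect the total
degree. -/
theorem mem_reedMuller_iff {r m : ℕ} {c : (Fin m → ZMod 2) → ZMod 2} :
    c ∈ reedMuller r m ↔
      ∃ P : MvPolynomial (Fin m) (ZMod 2), P.totalDegree ≤ r ∧ ∀ x, c x = eval x P := by
  constructor
  · rintro ⟨P, ⟨hP, -⟩, rfl⟩
    exact ⟨P, (mem_restrictTotalDegree _ _ _).1 hP, fun x => rfl⟩
  · rintro ⟨P, hP, hc⟩
    let red : (Fin m →₀ ℕ) → (Fin m →₀ ℕ) := fun d => d.mapRange (fun n => min n 1) rfl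
    refine ⟨∑ d ∈ P.support, monomial (red d) (P.coeff d), ⟨?_, ?_⟩, ?_⟩
    · refine Submodule.sum_mem _ fun d hd => (mem_restrictTotalDegree _ _ _).2 ?_
      refine (totalDegree_monomial_le _ _).trans (le_trans ?_ ((le_totalDegree hd).trans hP))
      rw [Finsupp.sum_fintype _ _ fun _ => rfl, Finsupp.sum_fintype _ _ fun _ => rfl]
      exact sum_le_sum fun i _ => by simp [red]
    · refine Submodule.sum_mem _ fun d hd => (mem_restrictDegree _ _ _).2 ?_
      intro s hs i
      have : s = red d := by
        have := support_monomial_subset hs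
        simpa using this
      simp [this, red]
    · funext x
      rw [evalₗ_apply, map_sum, hc, eval_eq']
      refine sum_congr rfl fun d _ => ?_
      rw [eval_monomial, Finsupp.prod_fintype _ _ fun _ => pow_zero _]
      simp only [red, Finsupp.mapRange_apply, zmod_two_pow_min_one]

theorem one_mem_reedMuller (r m : ℕ) : (fun _ => 1) ∈ reedMuller r m :=
  mem_reedMuller_iff.2 ⟨1, by simp, by simp⟩

/-- Reed-Muller codes are stable under linear substitutions. -/
theorem comp_linearMap_mem_reedMuller {r m n : ℕ} {c : (Fin n → ZMod 2) → ZMod 2}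
    (hc : c ∈ reedMuller r n) (L : (Fin m → ZMod 2) →ₗ[ZMod 2] (Fin n → ZMod 2)) :
    c ∘ L ∈ reedMuller r m := by
  obtain ⟨P, hP, hc⟩ := mem_reedMuller_iff.1 hc
  -- The linear forms giving the coordinates of `L x`; substituting them does not raise the degree.
  let l : Fin n → MvPolynomial (Fin m) (ZMod 2) := fun i =>
    ∑ j, C (L (Pi.single j 1) i) * X j
  have hl : ∀ i, (l i).totalDegree ≤ 1 := fun i =>
    totalDegree_finsetSum_le fun j _ => (totalDegree_mul _ _).trans (by simp)
  have hle : ∀ i x, eval x (l i) = L x i := by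
    intro i x
    have hs : ∀ j, (Pi.single j 1 : Fin m → ZMod 2) = fun k => if j = k then 1 else 0 := fun j => by
      ext k; simp [Pi.single_apply, eq_comm]
    rw [L.pi_apply_eq_sum_univ x]
    simp [l, hs, mul_comm]
  refine mem_reedMuller_iff.2
    ⟨∑ d ∈ P.support, C (P.coeff d) * ∏ i, l i ^ d i, ?_, fun x => ?_⟩
  · refine totalDegree_finsetSum_le fun d hd => ?_
    refine (totalDegree_mul _ _).trans ?_
    rw [totalDegree_C, zero_add]
    refine (totalDegree_finsetProd _ _).trans (le_trans ?_ ((le_totalDegree hd).trans hP))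
    rw [Finsupp.sum_fintype _ _ fun _ => rfl]
    refine sum_le_sum fun i _ => (totalDegree_pow _ _).trans ?_
    exact (Nat.mul_le_mul_left _ (hl i)).trans (mul_one _).le
  · simp only [Function.comp_apply, map_sum, map_mul, eval_C, map_prod, map_pow, hle, hc]
    rw [eval_eq']

/-! ### Averaging Fourier weight over subspaces. -/

/-- The points whose coordinates from `s` on vanish. -/
def headSubspace (s m : ℕ) : Submodule (ZMod 2) (Fin m → ZMod 2) where
  carrier := {x | ∀ i : Fin m, s ≤ i → x i = 0}
  add_mem' ha hb i hi := by simp [ha i hi, hb i hi]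
  zero_mem' _ _ := rfl
  smul_mem' c x hx i hi := by simp [hx i hi]

/-- Restriction to the first `s` coordinates. -/
noncomputable def headSubspaceEquiv {s m : ℕ} (h : s ≤ m) :
    headSubspace s m ≃ₗ[ZMod 2] (Fin s → ZMod 2) :=
  LinearEquiv.ofBijective
    ((LinearMap.funLeft (ZMod 2) (ZMod 2) (Fin.castLE h)).comp (headSubspace s m).subtype) <| by
    constructor
    · rintro ⟨x, hx⟩ ⟨y, hy⟩ hxy
      refine Subtype.ext (funext fun i => ?_)
      rcases lt_or_ge (i : ℕ) s with hi | hi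
      · exact congrFun hxy ⟨i, hi⟩
      · exact (hx i hi).trans (hy i hi).symm
    · intro y
      refine ⟨⟨fun i => if hi : (i : ℕ) < s then y ⟨i, hi⟩ else 0, fun i hi => ?_⟩, ?_⟩
      · simp [hi.not_gt]
      · funext i
        simp [LinearMap.funLeft]

theorem card_headSubspace {s m : ℕ} (h : s ≤ m) : Nat.card (headSubspace s m) = 2 ^ s := by
  rw [Nat.card_congr (headSubspaceEquiv h).toEquiv]
  simp

/-- The common kernel of `ℓ` functionals contains an automorphic image of `headSubspace`. -/
theorem exists_linearEquiv_headSubspace_le_ker {m ℓ : ℕ}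
    (φ : Fin ℓ → Module.Dual (ZMod 2) (Fin m → ZMod 2)) :
    ∃ T : (Fin m → ZMod 2) ≃ₗ[ZMod 2] (Fin m → ZMod 2),
      ∀ x ∈ headSubspace (m - ℓ) m, ∀ j, φ j (T x) = 0 := by
  set K := LinearMap.ker (LinearMap.pi φ) with hK
  -- Rank–nullity; the subtraction is truncated, so for `ℓ > m` the claim is only about the zero
  -- subspace.
  have hdim : m - ℓ ≤ Module.finrank (ZMod 2) K := by
    have h1 := (LinearMap.pi φ).finrank_range_add_finrank_ker
    have h2 := Submodule.finrank_le (LinearMap.range (LinearMap.pi φ))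
    rw [Module.finrank_fin_fun] at h1 h2
    rw [← hK] at h1
    omega
  obtain ⟨f, hf⟩ := exists_linearIndependent_of_le_finrank hdim
  have hinj : Function.Injective (K.subtype.comp (Fintype.linearCombination (ZMod 2) f)) :=
    K.injective_subtype.comp (hf.fintypeLinearCombination_injective)
  -- An isomorphism between two subspaces of a finite-dimensional space extends to an automorphism.
  obtain ⟨T, hT⟩ := Submodule.exists_linearEquiv_restrict_eq
    ((headSubspaceEquiv (Nat.sub_le m ℓ)).trans (LinearEquiv.ofInjective _ hinj))
  refine ⟨T, fun x hx j => ?_⟩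
  have h : T x ∈ K := by
    rw [← hT ⟨x, hx⟩]
    simp
  exact congrFun (LinearMap.mem_ker.1 h) j

noncomputable instance (m : ℕ) : Fintype (Module.Dual (ZMod 2) (Fin m → ZMod 2)) :=
  have : Finite (Module.Dual (ZMod 2) (Fin m → ZMod 2)) := Module.finite_of_finite (ZMod 2)
  Fintype.ofFinite _

open Classical in
/-- Few functionals vanish on many non-zero points. -/
theorem card_dual_vanishing_mul_le {m : ℕ} (S : Finset {x : Fin m → ZMod 2 // x ≠ 0}) :
    (univ.filter fun u : Module.Dual (ZMod 2) (Fin m → ZMod 2) => ∀ s ∈ S, u s = 0).card *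
      (S.card + 1) ≤ Fintype.card (Module.Dual (ZMod 2) (Fin m → ZMod 2)) := by
  set W := Submodule.span (ZMod 2) (S.map (Function.Embedding.subtype _) : Set (Fin m → ZMod 2))
    with hW
  have h1 : (univ.filter fun u : Module.Dual (ZMod 2) (Fin m → ZMod 2) => ∀ s ∈ S, u s = 0).card ≤
      Fintype.card W.dualAnnihilator := by
    rw [← Fintype.card_coe]
    refine Fintype.card_le_of_injective (fun u => ⟨u.1, ?_⟩) fun u v h => ?_
    · have hu := (mem_filter.1 u.2).2
      rw [Submodule.mem_dualAnnihilator]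
      intro w hw
      have : W ≤ LinearMap.ker u.1 := Submodule.span_le.2 fun x hx => by
        obtain ⟨s, hs, rfl⟩ := mem_map.1 (mem_coe.1 hx)
        exact hu s hs
      exact this hw
    · exact Subtype.ext (congrArg (fun z : W.dualAnnihilator => z.1) h)
  -- The extra `1` counts the origin, which lies in the span but not in `S`.
  have h2 : S.card + 1 ≤ Fintype.card W := by
    have h0 : (0 : Fin m → ZMod 2) ∉ S.map (Function.Embedding.subtype _) := by
      intro h
      obtain ⟨s, -, hs⟩ := mem_map.1 h
      exact s.2 hs
    rw [← card_map (Function.Embedding.subtype _), ← card_insert_of_notMem h0, ← Fintype.card_coe]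
    refine Fintype.card_le_of_injective (fun x => ⟨x.1, ?_⟩) fun x y h => ?_
    · rcases mem_insert.1 x.2 with h | h
      · rw [h]; exact W.zero_mem
      · exact Submodule.subset_span h
    · exact Subtype.ext (congrArg (fun z : W => z.1) h)
  refine (Nat.mul_le_mul h1 h2).trans_eq ?_
  rw [Module.card_eq_pow_finrank (K := ZMod 2) (V := W.dualAnnihilator),
    Module.card_eq_pow_finrank (K := ZMod 2) (V := W),
    Module.card_eq_pow_finrank (K := ZMod 2) (V := Module.Dual (ZMod 2) (Fin m → ZMod 2)),
    ← pow_add, add_comm, Subspace.finrank_add_finrank_dualAnnihilator_eq,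
    Subspace.dual_finrank_eq]

/-- The permutation of the non-zero points induced by a linear automorphism. -/
def nonzeroPerm {m : ℕ} (T : (Fin m → ZMod 2) ≃ₗ[ZMod 2] (Fin m → ZMod 2)) :
    {x : Fin m → ZMod 2 // x ≠ 0} ≃ {x : Fin m → ZMod 2 // x ≠ 0} :=
  T.toEquiv.subtypeEquiv fun x => by simp

theorem coe_nonzeroPerm {m : ℕ} (T : (Fin m → ZMod 2) ≃ₗ[ZMod 2] (Fin m → ZMod 2))
    (x : {x : Fin m → ZMod 2 // x ≠ 0}) : (nonzeroPerm T x : Fin m → ZMod 2) = T x := rfl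

open Classical in
/-- The weight that a `GL`-invariant function on sets of non-zero points gives to the subsets of a
subspace of codimension `ℓ`. -/
theorem sum_powerset_headSubspace_le {m : ℕ} (ℓ : ℕ)
    {w : Finset {x : Fin m → ZMod 2 // x ≠ 0} → ℝ} (hw : ∀ S, 0 ≤ w S)
    (hT : ∀ (T : (Fin m → ZMod 2) ≃ₗ[ZMod 2] (Fin m → ZMod 2)) S,
      w (S.map (nonzeroPerm T).toEmbedding) = w S)
    {K : Finset {x : Fin m → ZMod 2 // x ≠ 0}}
    (hK : ∀ x ∈ K, (x : Fin m → ZMod 2) ∈ headSubspace (m - ℓ) m) :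
    ∑ S ∈ K.powerset, w S ≤
      ∑ S, ((S.card : ℝ) + 1)⁻¹ ^ ℓ * w S := by
  set Φ := Fin ℓ → Module.Dual (ZMod 2) (Fin m → ZMod 2)
  set Q := ∑ S ∈ K.powerset, w S with hQ
  set V : Finset {x : Fin m → ZMod 2 // x ≠ 0} → Finset (Module.Dual (ZMod 2) (Fin m → ZMod 2)) :=
    fun S => univ.filter fun u => ∀ s ∈ S, u s = 0 with hV
  -- An automorphism carries the subspace into the common kernel of `φ` without changing weights, so
  -- `Q` is bounded by the weight of the sets killed by every `φ j`.
  have h1 : ∀ φ : Φ, Q ≤ ∑ S, if ∀ j, φ j ∈ V S then w S else 0 := by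
    intro φ
    obtain ⟨T, hTφ⟩ := exists_linearEquiv_headSubspace_le_ker φ
    rw [← sum_filter, hQ]
    have : ∀ S, w S = w ((Finset.mapEmbedding (nonzeroPerm T).toEmbedding).toEmbedding S) :=
      fun S => (hT T S).symm
    rw [sum_congr rfl fun S _ => this S, ← sum_map _ _ w]
    refine sum_le_sum_of_subset_of_nonneg (fun S hS => ?_) fun S _ _ => hw S
    obtain ⟨R, hR, rfl⟩ := mem_map.1 hS
    refine mem_filter.2 ⟨mem_univ _, fun j => mem_filter.2 ⟨mem_univ _, fun s hs => ?_⟩⟩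
    obtain ⟨x, hx, rfl⟩ := mem_map.1 (show s ∈ R.map (nonzeroPerm T).toEmbedding from hs)
    rw [Equiv.coe_toEmbedding, coe_nonzeroPerm]
    exact hTφ x.1 (hK x (mem_powerset.1 hR hx)) j
  set N : ℝ := ((Fintype.card (Module.Dual (ZMod 2) (Fin m → ZMod 2)) : ℕ) : ℝ) with hN
  have hN0 : 0 < N := by
    rw [hN]; exact_mod_cast Fintype.card_pos
  have hcardΦ : (Fintype.card Φ : ℝ) = N ^ ℓ := by simp [Φ, hN]
  -- Summing over all tuples: exactly `|V S|^ℓ` of them kill `S`.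
  have h2 : N ^ ℓ * Q ≤ ∑ S, ((V S).card : ℝ) ^ ℓ * w S := by
    calc N ^ ℓ * Q = ∑ φ : Φ, Q := by rw [sum_const, card_univ, nsmul_eq_mul, hcardΦ]
      _ ≤ ∑ φ : Φ, ∑ S, if ∀ j, φ j ∈ V S then w S else 0 := sum_le_sum fun φ _ => h1 φ
      _ = _ := by
        rw [sum_comm]
        refine sum_congr rfl fun S _ => ?_
        rw [← sum_filter, sum_const, nsmul_eq_mul]
        congr 1
        have : (univ.filter fun φ : Φ => ∀ j, φ j ∈ V S) = Fintype.piFinset fun _ => V S := by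
          ext φ; rw [mem_filter, Fintype.mem_piFinset]; exact and_iff_right (mem_univ _)
        rw [this, Fintype.card_piFinset]
        simp
  have h3 : ∀ S, ((V S).card : ℝ) ≤ N * ((S.card : ℝ) + 1)⁻¹ := by
    intro S
    rw [← div_eq_mul_inv, le_div_iff₀ (by positivity), hN]
    exact_mod_cast card_dual_vanishing_mul_le S
  refine le_of_mul_le_mul_left (h2.trans ?_) (pow_pos hN0 ℓ)
  rw [mul_sum]
  refine sum_le_sum fun S _ => ?_
  rw [← mul_assoc, ← mul_pow]
  exact mul_le_mul_of_nonneg_right (pow_le_pow_left₀ (by positivity) (h3 S) ℓ) (hw S)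

/-! ### Construction of the three looks. -/

/-- The coordinates used by the `j`-th of three looks. -/
def lookIndex (m ℓ : ℕ) (j : Fin 3) : Fin m ↪ Fin (m + 2 * ℓ) where
  -- The leading `m - ℓ` coordinates are shared; the trailing ones are shifted by `j * ℓ` into
  -- blocks disjoint for distinct `j`.
  toFun i := ⟨if (i : ℕ) < m - ℓ then i else i + j * ℓ, by
    have h := Nat.mul_le_mul_right ℓ (Nat.le_of_lt_succ j.2)
    split_ifs <;> omega⟩
  inj' a b h := by
    have h := Fin.mk.inj_iff.1 h
    ext
    split_ifs at h <;> omega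

theorem lookIndex_eq_imp {m ℓ : ℕ} {j k : Fin 3} (hjk : j ≠ k) {a b : Fin m}
    (h : lookIndex m ℓ j a = lookIndex m ℓ k b) : a = b ∧ (a : ℕ) < m - ℓ := by
  have h := Fin.mk.inj_iff.1 h
  have ha := a.2
  have hb := b.2
  refine ⟨Fin.ext ?_, ?_⟩ <;> fin_cases j <;> fin_cases k <;>
    simp at h hjk ⊢ <;> split_ifs at h <;> omega

/-- The points used by the `j`-th of three looks: extension by zero. -/
noncomputable def lookLinear (m ℓ : ℕ) (j : Fin 3) :
    (Fin m → ZMod 2) →ₗ[ZMod 2] (Fin (m + 2 * ℓ) → ZMod 2) :=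
  Function.ExtendByZero.linearMap (ZMod 2) (lookIndex m ℓ j)

theorem lookLinear_apply_lookIndex {m ℓ : ℕ} (j : Fin 3) (x : Fin m → ZMod 2) (i : Fin m) :
    lookLinear m ℓ j x (lookIndex m ℓ j i) = x i :=
  (lookIndex m ℓ j).injective.extend_apply _ _ _

theorem lookLinear_apply_of_notMem {m ℓ : ℕ} (j : Fin 3) (x : Fin m → ZMod 2)
    {k : Fin (m + 2 * ℓ)} (hk : ¬∃ i, lookIndex m ℓ j i = k) : lookLinear m ℓ j x k = 0 :=
  Function.extend_apply' _ _ _ hk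

/-- `lookLinear` as an embedding of code positions. -/
noncomputable def lookEmbedding (m ℓ : ℕ) (j : Fin 3) :
    (Fin m → ZMod 2) ↪ (Fin (m + 2 * ℓ) → ZMod 2) where
  toFun := lookLinear m ℓ j
  inj' x y h := funext fun i => by
    rw [← lookLinear_apply_lookIndex j x i, h, lookLinear_apply_lookIndex]

theorem lookEmbedding_zero (m ℓ : ℕ) (j : Fin 3) : lookEmbedding m ℓ j 0 = 0 :=
  map_zero (lookLinear m ℓ j)

theorem comp_lookEmbedding_mem {r m ℓ : ℕ} (j : Fin 3) {c : (Fin (m + 2 * ℓ) → ZMod 2) → ZMod 2}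
    (hc : c ∈ reedMuller r (m + 2 * ℓ)) : c ∘ lookEmbedding m ℓ j ∈ reedMuller r m :=
  comp_linearMap_mem_reedMuller hc (lookLinear m ℓ j)

/-- Two looks overlap in the images of `headSubspace (m - ℓ) m` only. -/
theorem lookEmbedding_eq_imp {m ℓ : ℕ} {j k : Fin 3} (hjk : j ≠ k) {x y : Fin m → ZMod 2}
    (h : lookEmbedding m ℓ j x = lookEmbedding m ℓ k y) :
    x = y ∧ x ∈ headSubspace (m - ℓ) m := by
  have key : ∀ {j k : Fin 3}, j ≠ k → ∀ {x y : Fin m → ZMod 2},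
      lookLinear m ℓ j x = lookLinear m ℓ k y → ∀ i : Fin m, x i = y i ∨ x i = 0 := by
    intro j k hjk x y h i
    have h1 : x i = lookLinear m ℓ k y (lookIndex m ℓ j i) := by
      rw [← h, lookLinear_apply_lookIndex]
    by_cases hi : ∃ i', lookIndex m ℓ k i' = lookIndex m ℓ j i
    · obtain ⟨i', hi'⟩ := hi
      obtain ⟨rfl, -⟩ := lookIndex_eq_imp hjk hi'.symm
      rw [← hi', lookLinear_apply_lookIndex] at h1
      exact .inl h1
    · exact .inr (h1.trans (lookLinear_apply_of_notMem k y hi))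
  have hzero : ∀ i : Fin m, m - ℓ ≤ i → x i = 0 := by
    intro i hi
    have h1 : x i = lookLinear m ℓ k y (lookIndex m ℓ j i) := by
      rw [← show lookLinear m ℓ j x = lookLinear m ℓ k y from h, lookLinear_apply_lookIndex]
    rw [h1]
    refine lookLinear_apply_of_notMem k y ?_
    rintro ⟨i', hi'⟩
    have := (lookIndex_eq_imp hjk hi'.symm).2
    omega
  refine ⟨funext fun i => ?_, hzero⟩
  rcases key hjk h i with h1 | h1
  · exact h1
  · rcases key hjk.symm h.symm i with h2 | h2
    · exact h2.symm
    · rw [h1, h2]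

/-- On `headSubspace (m - ℓ) m` all looks agree. -/
theorem lookEmbedding_congr {m ℓ : ℕ} (j k : Fin 3) {x : Fin m → ZMod 2}
    (hx : x ∈ headSubspace (m - ℓ) m) : lookEmbedding m ℓ j x = lookEmbedding m ℓ k x := by
  have key : ∀ j k : Fin 3, ∀ a : Fin m,
      lookLinear m ℓ j x (lookIndex m ℓ j a) = lookLinear m ℓ k x (lookIndex m ℓ j a) := by
    intro j k a
    rw [lookLinear_apply_lookIndex]
    by_cases ha : (a : ℕ) < m - ℓ
    · have : lookIndex m ℓ j a = lookIndex m ℓ k a := by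
        refine Fin.ext ?_
        change (if (a : ℕ) < m - ℓ then (a : ℕ) else _) = if (a : ℕ) < m - ℓ then (a : ℕ) else _
        rw [if_pos ha, if_pos ha]
      rw [this, lookLinear_apply_lookIndex]
    · rw [hx a (not_lt.1 ha)]
      by_cases hb : ∃ b, lookIndex m ℓ k b = lookIndex m ℓ j a
      · obtain ⟨b, hb⟩ := hb
        rw [← hb, lookLinear_apply_lookIndex]
        by_cases hjk : j = k
        · subst hjk
          rw [(lookIndex m ℓ j).injective hb, hx a (not_lt.1 ha)]
        · exact absurd (lookIndex_eq_imp hjk hb.symm).2 ha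
      · exact (lookLinear_apply_of_notMem k x hb).symm
  funext i
  change lookLinear m ℓ j x i = lookLinear m ℓ k x i
  by_cases hj : ∃ a, lookIndex m ℓ j a = i
  · obtain ⟨a, rfl⟩ := hj
    exact key j k a
  · by_cases hk : ∃ a, lookIndex m ℓ k a = i
    · obtain ⟨a, rfl⟩ := hk
      exact (key k j a).symm
    · rw [lookLinear_apply_of_notMem j x hj, lookLinear_apply_of_notMem k x hk]

/-- Surjectivity of the projection: reading off the coordinates `lookIndex` is a linear left inverse
of `lookLinear`, so each codeword of `RM(r, m)` extends by composition. -/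
theorem isLook_map_lookEmbedding (r m ℓ : ℕ) (j : Fin 3) :
    IsLook (reedMuller r (m + 2 * ℓ)) 0 (reedMuller r m) 0 (univ.map (lookEmbedding m ℓ j)) := by
  refine ⟨Equiv.ofBijective (fun x => ⟨lookEmbedding m ℓ j x, mem_map_of_mem _ (mem_univ x)⟩)
    ⟨fun x y h => (lookEmbedding m ℓ j).injective (congrArg Subtype.val h), ?_⟩,
    lookEmbedding_zero m ℓ j, ?_⟩
  · rintro ⟨y, hy⟩
    obtain ⟨x, -, rfl⟩ := mem_map.1 hy
    exact ⟨x, rfl⟩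
  ext c
  constructor
  · rintro ⟨c, hc, rfl⟩
    exact comp_lookEmbedding_mem j hc
  · intro hc
    refine ⟨c ∘ LinearMap.funLeft (ZMod 2) (ZMod 2) (lookIndex m ℓ j),
      comp_linearMap_mem_reedMuller hc _, ?_⟩
    funext x
    change c _ = c x
    congr 1
    funext i
    exact lookLinear_apply_lookIndex j x i

open Classical in
-- `A` is the common image of the non-zero points of `headSubspace (m - ℓ) m`, and `B j` the `j`-th
-- image of its complement. The condition `ℓ ≤ m` makes the codimension exactly `ℓ`.
theorem reedMuller_three_looks (r m ℓ : ℕ) (hℓ : ℓ ≤ m) :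
    ∃ (A : Finset (Fin (m + 2 * ℓ) → ZMod 2)) (B : Fin 3 → Finset (Fin (m + 2 * ℓ) → ZMod 2)),
      0 ∉ A ∧ (∀ i, 0 ∉ B i) ∧ (∀ i, Disjoint A (B i)) ∧
      (∀ i j, i ≠ j → Disjoint (B i) (B j)) ∧
      (∀ i, IsLook (reedMuller r (m + 2 * ℓ)) 0 (reedMuller r m) 0 (insert 0 (A ∪ B i))) ∧
      (∀ i, ((insert 0 A).card : ℝ) / ((insert 0 (A ∪ B i)).card : ℝ) = 2 ^ (-(ℓ : ℤ))) := by
  let H : Finset (Fin m → ZMod 2) := univ.filter fun x => x ∈ headSubspace (m - ℓ) m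
  have hH : ∀ x, x ∈ H ↔ x ∈ headSubspace (m - ℓ) m := fun x => by simp [H]
  have h0H : 0 ∈ H := (hH 0).2 (Submodule.zero_mem _)
  have hAj : ∀ j, (H.erase 0).map (lookEmbedding m ℓ 0) = (H.erase 0).map (lookEmbedding m ℓ j) := by
    intro j
    ext y
    simp only [mem_map]
    exact exists_congr fun x => and_congr_right fun hx => by
      rw [lookEmbedding_congr 0 j ((hH x).1 (mem_of_mem_erase hx))]
  have hins : ∀ j, insert 0 ((H.erase 0).map (lookEmbedding m ℓ j)) =
      H.map (lookEmbedding m ℓ j) := by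
    intro j
    conv_lhs => rw [← lookEmbedding_zero m ℓ j]
    rw [← map_insert, insert_erase h0H]
  have hall : ∀ j, insert 0 ((H.erase 0).map (lookEmbedding m ℓ 0) ∪
      Hᶜ.map (lookEmbedding m ℓ j)) = univ.map (lookEmbedding m ℓ j) := by
    intro j
    rw [hAj j, ← insert_union, hins, ← map_union, union_compl]
  refine ⟨(H.erase 0).map (lookEmbedding m ℓ 0), fun j => Hᶜ.map (lookEmbedding m ℓ j),
    ?_, ?_, ?_, ?_, ?_, ?_⟩
  · rw [← lookEmbedding_zero m ℓ 0, mem_map']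
    simp
  · intro j
    rw [← lookEmbedding_zero m ℓ j, mem_map']
    simpa using h0H
  · intro j
    rw [hAj j, disjoint_map]
    exact disjoint_compl_right.mono_left (erase_subset _ _)
  · intro i j hij
    rw [disjoint_left]
    rintro y hi hj
    obtain ⟨a, ha, rfl⟩ := mem_map.1 hi
    obtain ⟨b, -, hb⟩ := mem_map.1 hj
    exact (mem_compl.1 ha) ((hH a).2 (lookEmbedding_eq_imp hij hb.symm).2)
  · intro j
    have h := isLook_map_lookEmbedding r m ℓ j
    rw [← hall j] at h
    convert h
  · intro j
    have h1 := congrArg card (hall j)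
    have h2 := congrArg card (hins 0)
    have h3 : H.card = 2 ^ (m - ℓ) := by
      rw [← card_headSubspace (Nat.sub_le m ℓ), Nat.card_eq_fintype_card, Fintype.card_subtype]
    rw [card_map, h3] at h2
    rw [card_map, card_univ, Fintype.card_fun, ZMod.card, Fintype.card_fin] at h1
    have h1' : (insert 0 ((H.erase 0).map (lookEmbedding m ℓ 0) ∪
      Hᶜ.map (lookEmbedding m ℓ j))).card = 2 ^ m := by convert h1
    have h2' : (insert 0 ((H.erase 0).map (lookEmbedding m ℓ 0))).card = 2 ^ (m - ℓ) := by
      convert h2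
    have hm : (2 : ℝ) ^ m = 2 ^ (m - ℓ) * 2 ^ ℓ := by rw [← pow_add, Nat.sub_add_cancel hℓ]
    simp only [h1', h2']
    push_cast
    rw [hm, zpow_neg, zpow_natCast]
    field_simp

end ReedMuller

/-! ### Quantitative bounds and the choice of level. -/

section Bounds

variable {p : ℝ}

theorem log_one_div_min_ge (hp0 : 0 < p) (hp1 : p < 1) :
    Real.log 2 ≤ Real.log (1 / min p (1 - p)) := by
  have hlam : 0 < min p (1 - p) := lt_min hp0 (by linarith)
  refine Real.log_le_log (by norm_num) ?_
  rw [le_div_iff₀ hlam]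
  rcases min_cases p (1 - p) with ⟨h, h'⟩ | ⟨h, h'⟩ <;> linarith

theorem levelConst_pos (hp0 : 0 < p) (hp1 : p < 1) : 0 < levelConst p := by
  have h1 := log_one_div_min_ge hp0 hp1
  have h2 := Real.log_pos one_lt_two
  have h3 : 0 < Real.log (1 / min p (1 - p)) := h2.trans_le h1
  unfold levelConst
  positivity

theorem levelConst_le (hp0 : 0 < p) (hp1 : p < 1) : levelConst p ≤ 1 / 5 := by
  have h1 := log_one_div_min_ge hp0 hp1
  have h2 := Real.log_two_gt_d9
  unfold levelConst
  exact one_div_le_one_div_of_le (by norm_num) (by linarith)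

/-- The level inequality at level `c ln (1 / P)`. -/
theorem sum_biasedCoeff_sq_le_rpow {ι : Type*} [Fintype ι] [DecidableEq ι] (hp0 : 0 < p)
    (hp1 : p < 1) {F : (ι → ZMod 2) → ℝ} (hF0 : ∀ z, 0 ≤ F z) (hF1 : ∀ z, F z ≤ 1)
    (hP : 0 < noiseExp p F) {k : ℕ} (hk : (k : ℝ) ≤ levelConst p * -Real.log (noiseExp p F)) :
    ∑ S with S.card ≤ k, biasedCoeff p F S ^ 2 ≤ noiseExp p F ^ (7 / 6 : ℝ) := by
  set P := noiseExp p F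
  have hlam : 0 < min p (1 - p) := lt_min hp0 (by linarith)
  have h1 := log_one_div_min_ge hp0 hp1
  have h2 := Real.log_pos one_lt_two
  set Λ := Real.log (1 / min p (1 - p)) with hΛ
  have hΛ0 : 0 < Λ := h2.trans_le h1
  -- `9 ≤ 16 = exp (4 ln 2) ≤ exp (4 Λ)`, since `Λ ≥ ln 2`.
  have hM : 9 / min p (1 - p) ≤ Real.exp (5 * Λ) := by
    have e1 : Real.exp Λ = 1 / min p (1 - p) := Real.exp_log (by positivity)
    have e2 : Real.exp (4 * Real.log 2) = 16 := by
      rw [mul_comm, Real.exp_mul, Real.exp_log two_pos]; norm_num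
    have e3 : (9 : ℝ) ≤ Real.exp (4 * Λ) := by
      have := Real.exp_le_exp.2 (mul_le_mul_of_nonneg_left h1 (by norm_num : (0 : ℝ) ≤ 4))
      linarith
    calc 9 / min p (1 - p) = 9 * Real.exp Λ := by rw [e1]; ring
      _ ≤ Real.exp (4 * Λ) * Real.exp Λ := by gcongr
      _ = _ := by rw [← Real.exp_add]; ring_nf
  have hkΛ : (k : ℝ) * (8 * Λ) ≤ -Real.log P := by
    have : levelConst p * -Real.log P = -Real.log P / (8 * Λ) := by
      rw [levelConst]; ring
    rw [this, le_div_iff₀ (by positivity)] at hk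
    exact hk
  refine abs_le_of_sq_le_sq' ?_ (by positivity) |>.2
  calc _ ≤ P ^ 3 * (9 / min p (1 - p)) ^ k := sum_biasedCoeff_sq_low_degree_le hp0 hp1 hF0 hF1 k
    _ ≤ P ^ 3 * Real.exp (5 * Λ) ^ k := by gcongr
    _ = Real.exp (3 * Real.log P + k * (5 * Λ)) := by
      rw [← Real.exp_nat_mul, Real.exp_add]
      congr 1
      rw [mul_comm, Real.exp_mul, Real.exp_log hP]; norm_cast
    -- From `k Λ ≤ ln(1/P) / 8` the exponent of `P` is at least `3 - 5/8 = 19/8`, which exceeds `2 ·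
    -- 7/6 = 7/3`.
    _ ≤ Real.exp (Real.log P * (7 / 6) * 2) := by
      refine Real.exp_le_exp.2 ?_
      have : 0 ≤ (k : ℝ) * Λ := by positivity
      linarith
    _ = (P ^ (7 / 6 : ℝ)) ^ 2 := by
      rw [Real.rpow_def_of_pos hP, ← Real.exp_nat_mul]
      congr 1; push_cast; ring

/-- Splitting a weighted sum over sets into the empty set, the small sets and the large sets. -/
theorem sum_inv_card_add_one_pow_mul_le {α : Type*} [Fintype α] [DecidableEq α] {w : Finset α → ℝ}
    (hw : ∀ S, 0 ≤ w S) {x : ℝ} (hx : 0 < x) (ℓ : ℕ) :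
    ∑ S, ((S.card : ℝ) + 1)⁻¹ ^ ℓ * w S ≤
      w ∅ + (2 : ℝ)⁻¹ ^ ℓ * ∑ S with S.card ≤ ⌊x⌋₊, w S + x⁻¹ ^ ℓ * ∑ S, w S := by
  -- A non-empty `S` has `|S| + 1 ≥ 2`; beyond the level `⌊x⌋` it has `|S| + 1 ≥ x`.
  have hterm : ∀ S : Finset α, ((S.card : ℝ) + 1)⁻¹ ^ ℓ * w S ≤
      (if S = ∅ then w S else 0) + (2 : ℝ)⁻¹ ^ ℓ * (if S.card ≤ ⌊x⌋₊ then w S else 0) +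
        x⁻¹ ^ ℓ * w S := by
    intro S
    have hS0 := hw S
    have n2 : 0 ≤ (2 : ℝ)⁻¹ ^ ℓ * (if S.card ≤ ⌊x⌋₊ then w S else 0) := by
      split_ifs <;> positivity
    have n3 : 0 ≤ x⁻¹ ^ ℓ * w S := by positivity
    rcases eq_or_ne S ∅ with rfl | hS
    · have e : (((∅ : Finset α).card : ℝ) + 1)⁻¹ ^ ℓ * w ∅ = w ∅ := by simp
      rw [if_pos rfl, e]
      linarith
    · rw [if_neg hS]
      by_cases hSk : S.card ≤ ⌊x⌋₊
      · have h1 : (1 : ℝ) ≤ S.card := by exact_mod_cast card_pos.2 (nonempty_iff_ne_empty.2 hS)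
        have : ((S.card : ℝ) + 1)⁻¹ ^ ℓ * w S ≤ (2 : ℝ)⁻¹ ^ ℓ * w S := by
          gcongr; linarith
        rw [if_pos hSk]
        linarith
      · have h1 : x ≤ (S.card : ℝ) + 1 := by
          have h2 := (Nat.lt_floor_add_one x).le
          have h3 : (⌊x⌋₊ : ℝ) ≤ S.card := by exact_mod_cast (not_le.1 hSk).le
          linarith
        have : ((S.card : ℝ) + 1)⁻¹ ^ ℓ * w S ≤ x⁻¹ ^ ℓ * w S := by
          gcongr
        linarith
  refine (sum_le_sum fun S _ => hterm S).trans_eq ?_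
  rw [sum_add_distrib, sum_add_distrib, ← mul_sum, ← mul_sum, sum_filter,
    sum_ite_eq' univ (∅ : Finset α), if_pos (mem_univ _)]

theorem extrinsicBitErrorProb_reedMuller_le (hp0 : 0 < p) (hp1 : p < 1) {r m : ℕ} {g'}
    (hg' : IsExtrinsicBitMAP p (reedMuller r m) 0 g') {ℓ : ℕ} {g}
    (hg : IsExtrinsicBitMAP p (reedMuller r (m + 2 * ℓ)) 0 g) :
    extrinsicBitErrorProb p (reedMuller r (m + 2 * ℓ)) 0 g ≤
      3 * (extrinsicBitErrorProb p (reedMuller r m) 0 g' ^ 2 +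
        (2 : ℝ) ^ (-(ℓ : ℤ)) * extrinsicBitErrorProb p (reedMuller r m) 0 g' ^ (7 / 6 : ℝ) +
        (-levelConst p * Real.log (extrinsicBitErrorProb p (reedMuller r m) 0 g')) ^ (-(ℓ : ℤ)) *
          extrinsicBitErrorProb p (reedMuller r m) 0 g') := by
  classical
  have hP0 := extrinsicBitErrorProb_pos hp0 hp1 (one_mem_reedMuller r m) hg'
  have hP1 := extrinsicBitErrorProb_le_half hg'
  set F := softMAP p (reedMuller r m) 0 with hF
  have hPF : extrinsicBitErrorProb p (reedMuller r m) 0 g' = noiseExp p F :=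
    extrinsicBitErrorProb_eq_noiseExp_softMAP hg'
  set P := extrinsicBitErrorProb p (reedMuller r m) 0 g' with hP
  have hI := softMAP_mem_Icc (p := p) (reedMuller r m) 0
  refine extrinsicBitErrorProb_le_of_three_looks hp0 hp1 hg
    (isEquivariantDecoder_softMAP (p := p) (reedMuller r m) 0) hI (lookEmbedding m ℓ)
    (lookEmbedding_zero m ℓ) (fun j x hx => comp_lookEmbedding_mem j hx) fun i j hij => ?_
  set K := univ.filter fun x : {x : Fin m → ZMod 2 // x ≠ 0} =>
    (x : Fin m → ZMod 2) ∈ headSubspace (m - ℓ) m with hK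
  have hov := noiseExp_comp_mul_comp hp0 hp1 F
    (restrictNe (lookEmbedding m ℓ i) (lookEmbedding_zero m ℓ i))
    (restrictNe (lookEmbedding m ℓ j) (lookEmbedding_zero m ℓ j)) K fun a b hab => by
      obtain ⟨h1, h2⟩ := lookEmbedding_eq_imp hij (congrArg Subtype.val hab)
      exact ⟨Subtype.ext h1, by rw [hK, mem_filter]; exact ⟨mem_univ _, h2⟩⟩
  -- Linear automorphisms fix the origin and preserve the code, so the optimal decoder and its
  -- spectrum are invariant.
  have hsym : ∀ (T : (Fin m → ZMod 2) ≃ₗ[ZMod 2] (Fin m → ZMod 2))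
      (S : Finset {x : Fin m → ZMod 2 // x ≠ 0}),
      biasedCoeff p F (S.map (nonzeroPerm T).toEmbedding) ^ 2 = biasedCoeff p F S ^ 2 := by
    intro T S
    rw [biasedCoeff_map_equiv]
    refine softMAP_comp_equiv T.toEquiv (map_zero T) (fun x => ⟨fun hx => ?_, fun hx => ?_⟩)
      (nonzeroPerm T) (fun x => rfl)
    · have := comp_linearMap_mem_reedMuller hx T.symm.toLinearMap
      convert this using 1
      funext y
      simp
    · exact comp_linearMap_mem_reedMuller hx T.toLinearMap
  have havg := sum_powerset_headSubspace_le ℓ (fun S => sq_nonneg (biasedCoeff p F S)) hsym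
    (K := K) fun x hx => (mem_filter.1 hx).2
  refine hov.trans (havg.trans ?_)
  have hL : 0 < -Real.log P := neg_pos.2 (Real.log_neg hP0 (by linarith))
  have hcL : 0 < levelConst p * -Real.log P := mul_pos (levelConst_pos hp0 hp1) hL
  set k := ⌊levelConst p * -Real.log P⌋₊ with hk
  have hlow : ∑ S with S.card ≤ k, biasedCoeff p F S ^ 2 ≤ P ^ (7 / 6 : ℝ) := by
    rw [hPF]
    refine sum_biasedCoeff_sq_le_rpow hp0 hp1 (fun z => (hI z).1) (fun z => (hI z).2)
      (hPF ▸ hP0) ?_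
    rw [← hPF]
    exact Nat.floor_le hcL.le
  -- Parseval together with `F² ≤ F`.
  have hall : ∑ S, biasedCoeff p F S ^ 2 ≤ P := by
    rw [sum_biasedCoeff_sq hp0 hp1, hPF]
    exact noiseExp_mono hp0 hp1 fun z => by
      have h0 := (hI z).1
      have h1 := (hI z).2
      rw [← hF] at h0 h1
      nlinarith
  have hempty : biasedCoeff p F ∅ = P := by
    rw [hPF, biasedCoeff]
    simp [biasedChar]
  have e2 : (2 : ℝ) ^ (-(ℓ : ℤ)) = (2 : ℝ)⁻¹ ^ ℓ := by rw [zpow_neg, zpow_natCast, inv_pow]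
  have e3 : (-levelConst p * Real.log P) ^ (-(ℓ : ℤ)) = (levelConst p * -Real.log P)⁻¹ ^ ℓ := by
    rw [zpow_neg, zpow_natCast, inv_pow, neg_mul_comm]
  have hsplit := sum_inv_card_add_one_pow_mul_le (fun S => sq_nonneg (biasedCoeff p F S)) hcL ℓ
  rw [hempty] at hsplit
  rw [e2, e3]
  refine hsplit.trans (add_le_add (add_le_add le_rfl ?_) ?_)
  · exact mul_le_mul_of_nonneg_left hlow (by positivity)
  · exact mul_le_mul_of_nonneg_left hall (by positivity)

/-- The maximum is `4 e^(-2) ≈ 0.54`, at `x = 2`, where the tangent-line bound on the exponential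
used here is sharp. -/
theorem sq_mul_exp_neg_le {x : ℝ} (hx : 0 ≤ x) : x ^ 2 * Real.exp (-x) ≤ 3 / 5 := by
  have h1 : x / 2 ≤ Real.exp (x / 2 - 1) := by
    have := Real.add_one_le_exp (x / 2 - 1); linarith
  have h2 : (x / 2) ^ 2 ≤ Real.exp (x / 2 - 1) ^ 2 := pow_le_pow_left₀ (by positivity) h1 2
  have h3 : Real.exp (x / 2 - 1) ^ 2 * Real.exp (-x) = Real.exp (-1) ^ 2 := by
    rw [← Real.exp_nat_mul, ← Real.exp_nat_mul, ← Real.exp_add]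
    congr 1; push_cast; ring
  have h4 : Real.exp (-1) ^ 2 ≤ (3 / 20 : ℝ) := by
    have := Real.exp_neg_one_lt_d9
    have h5 := Real.exp_pos (-1)
    nlinarith
  have h5 := mul_le_mul_of_nonneg_right h2 (Real.exp_pos (-x)).le
  rw [h3] at h5
  linarith

/-- With `L = ln(1/P)`, the last term is `3 P / (cL)²` and the target is `4 P / (cL)²`, so the first
two terms must fit into `P / (cL)²`. -/
theorem two_fold_boost_le {c P : ℝ} (hc0 : 0 < c) (hc : c ≤ 1 / 5) (hP0 : 0 < P)
    (hP1 : P ≤ 1 / 2) :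
    3 * (P ^ 2 + (2 : ℝ) ^ (-(2 : ℤ)) * P ^ (7 / 6 : ℝ) + (-c * Real.log P) ^ (-(2 : ℤ)) * P) ≤
      P * (2 / (c * Real.log (1 / P))) ^ 2 := by
  set L := -Real.log P with hL
  have hL0 : 0 < L := neg_pos.2 (Real.log_neg hP0 (by linarith))
  have hPL : P = Real.exp (-L) := by rw [hL, neg_neg, Real.exp_log hP0]
  have hlog : Real.log P = -L := by rw [hL, neg_neg]
  have e1 : P ^ (7 / 6 : ℝ) = P * Real.exp (-(L / 6)) := by
    rw [Real.rpow_def_of_pos hP0, hlog, hPL, ← Real.exp_add]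
    congr 1; ring
  have h1 := sq_mul_exp_neg_le hL0.le
  have h2 := sq_mul_exp_neg_le (x := L / 6) (by positivity)
  rw [← hPL] at h1
  have key : (3 * P + 3 / 4 * Real.exp (-(L / 6))) * (c * L) ^ 2 ≤ 1 := by
    -- `3 · 3/5 + 3/4 · 36 · 3/5 = 18`, and `18 / 25 < 1`.
    have h3 : (3 * P + 3 / 4 * Real.exp (-(L / 6))) * L ^ 2 ≤ 18 := by nlinarith
    have h4 : c ^ 2 ≤ 1 / 25 := by nlinarith
    have h5 : 0 ≤ (3 * P + 3 / 4 * Real.exp (-(L / 6))) * L ^ 2 := by positivity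
    nlinarith
  have hcL : 0 < c * L := mul_pos hc0 hL0
  rw [one_div, Real.log_inv, ← hL, e1, hlog, neg_mul_neg, zpow_neg, zpow_neg]
  norm_num only [zpow_ofNat]
  rw [← le_div_iff₀ (by positivity)] at key
  have := mul_le_mul_of_nonneg_left key hP0.le
  calc _ = P * (3 * P + 3 / 4 * Real.exp (-(L / 6))) + 3 * (P * (1 / (c * L) ^ 2)) := by
        field_simp
      _ ≤ P * (1 / (c * L) ^ 2) + 3 * (P * (1 / (c * L) ^ 2)) := by gcongr
      _ = _ := by field_simp; ring

end Bounds

theorem lemma16 (p : ℝ) (hp0 : 0 < p) (hp1 : p < 1) (r m : ℕ) :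
    -- `RM(r, m + 2ℓ)` contains three `RM(r, m)` looks at bit `0` with fractional overlap `2^{-ℓ}`
    (∀ ℓ : ℕ, ℓ ≤ m →
      ∃ (A : Finset (Fin (m + 2 * ℓ) → ZMod 2)) (B : Fin 3 → Finset (Fin (m + 2 * ℓ) → ZMod 2)),
        0 ∉ A ∧ (∀ i, 0 ∉ B i) ∧ (∀ i, Disjoint A (B i)) ∧
        (∀ i j, i ≠ j → Disjoint (B i) (B j)) ∧
        (∀ i, IsLook (reedMuller r (m + 2 * ℓ)) 0 (reedMuller r m) 0 (insert 0 (A ∪ B i))) ∧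
        (∀ i, ((insert 0 A).card : ℝ) / ((insert 0 (A ∪ B i)).card : ℝ) = 2 ^ (-(ℓ : ℤ)))) ∧
    -- the bounds on the extrinsic bit error rates `P = P_b(C)` and `P' = P_b(C')`
    (∀ g', IsExtrinsicBitMAP p (reedMuller r m) 0 g' →
      (∀ (ℓ : ℕ) (g), IsExtrinsicBitMAP p (reedMuller r (m + 2 * ℓ)) 0 g →
        let P := extrinsicBitErrorProb p (reedMuller r (m + 2 * ℓ)) 0 g
        let P' := extrinsicBitErrorProb p (reedMuller r m) 0 g'
        P ≤ 3 * (P' ^ 2 + (2 : ℝ) ^ (-(ℓ : ℤ)) * P' ^ (7 / 6 : ℝ) +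
          (-levelConst p * Real.log P') ^ (-(ℓ : ℤ)) * P')) ∧
      (∀ g, IsExtrinsicBitMAP p (reedMuller r (m + 4)) 0 g →
        let P := extrinsicBitErrorProb p (reedMuller r (m + 4)) 0 g
        let P' := extrinsicBitErrorProb p (reedMuller r m) 0 g'
        P ≤ P' * (2 / (levelConst p * Real.log (1 / P'))) ^ 2)) := by
  refine ⟨fun ℓ hℓ => ?_, fun g' hg' => ⟨fun ℓ g hg => ?_, fun g hg => ?_⟩⟩
  · obtain ⟨A, B, hA, hB, hAB, hBB, hl, hc⟩ := reedMuller_three_looks r m ℓ hℓ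
    refine ⟨A, B, hA, hB, hAB, hBB, fun i => ?_, fun i => ?_⟩
    · convert hl i
    · convert hc i
  · exact extrinsicBitErrorProb_reedMuller_le hp0 hp1 hg' hg
  · exact (extrinsicBitErrorProb_reedMuller_le hp0 hp1 hg' (ℓ := 2) hg).trans
      (two_fold_boost_le (levelConst_pos hp0 hp1) (levelConst_le hp0 hp1)
        (extrinsicBitErrorProb_pos hp0 hp1 (one_mem_reedMuller r m) hg')
        (extrinsicBitErrorProb_le_half hg'))
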